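/- Let $(M,\mu)$ and $(N,\nu)$ be measure spaces, where $\mu$ is localizable: every measurable set of infinite $\mu$-measure contains a measurable subset of positive finite measure, and the real Banach lattice $L^\infty(\mu)$ is Dedekind complete (every nonempty subset that is bounded above has a least upper bound); for instance $\mu$ may be any $\sigma$-finite measure. There is no restriction on $\nu$. All spaces are over the real scalars. Let $B_0=B(L^\infty(\nu),L^\infty(\mu))$ and $B_1=B(L^1(\nu),L^1(\mu))$ be the spaces of bounded linear operators with the operator norms. Every element of $B_0$ or $B_1$ is identified with the linear map from $L^1(\nu)\cap L^\infty(\nu)$ to $L^1(\mu)+L^\infty(\mu)$ that it induces, and $B_0+B_1$ is formed inside the space of all such linear maps. For $u\in B_0+B_1$ and $t>0$ let $$K_t(u;B_0,B_1)=\inf\{\|b_0\|+t\|b_1\| : b_0\in B_0,\ b_1\in B_1,\ u(f)=b_0(f)+b_1(f)\ \text{for all } f\in L^1(\nu)\cap L^\infty(\nu)\}.$$ **Theorem 4.1.** Every $u\in B_0+B_1$ has a modulus $|u|:L^1(\nu)\cap L^\infty(\nu)\to L^1(\mu)+L^\infty(\mu)$, that is, a least upper bound of $u$ and $-u$ for the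 order on linear maps in which $v\le w$ means $v(f)\le w(f)$ for all $f\ge 0$. Put $$|||u|||_t=\sup_{E,F}\ \big(\mu(E)\vee t^{-1}\nu(F)\big)^{-1}\,\big\langle |u|(1_F),1_E\big\rangle,$$ where the supremum runs over all measurable $E\subset M$ and $F\subset N$ of positive finite measure (it is $0$ if there are no such $E,F$), $a\vee b=\max(a,b)$ and $\langle g,1_E\rangle=\int_E g\,d\mu$. Then for every $t>0$, $$\tfrac12\,K_t(u;B_0,B_1)\le |||u|||_t\le K_t(u;B_0,B_1).$$ -/

import Mathlib

open MeasureTheory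
open scoped ENNReal

noncomputable section

namespace OpInterp

/-- Every measurable set of infinite measure contains a measurable set of
positive finite measure. -/
def IsSemifinite {M : Type*} [MeasurableSpace M] (μ : Measure M) : Prop :=
  ∀ A : Set M, MeasurableSet A → μ A = ∞ →
    ∃ B : Set M, B ⊆ A ∧ MeasurableSet B ∧ 0 < μ B ∧ μ B < ∞

/-- The real Banach lattice `L^∞(μ)` (with the almost everywhere order) is Dedekind complete. -/
def LinftyDedekindComplete {M : Type*} [MeasurableSpace M] (μ : Measure M) : Prop :=
  ∀ S : Set (Lp ℝ ∞ μ), S.Nonempty → BddAbove S → ∃ g : Lp ℝ ∞ μ, IsLUB S g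

/-- `μ` is localizable. -/
structure IsLocalizable {M : Type*} [MeasurableSpace M] (μ : Measure M) : Prop where
  semifinite : IsSemifinite μ
  dedekindComplete : LinftyDedekindComplete μ

/-- The space `L^1(ν) ∩ L^∞(ν)`, as a space of almost everywhere classes of functions. -/
abbrev InterSpace {N : Type*} [MeasurableSpace N] (ν : Measure N) :
    Submodule ℝ (N →ₘ[ν] ℝ) :=
  Lp.LpSubmodule ℝ ℝ 1 ν ⊓ Lp.LpSubmodule ℝ ℝ ∞ ν

/-- The space `L^1(μ) + L^∞(μ)`, as a space of almost everywhere classes of functions. -/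
abbrev SumSpace {M : Type*} [MeasurableSpace M] (μ : Measure M) :
    Submodule ℝ (M →ₘ[μ] ℝ) :=
  Lp.LpSubmodule ℝ ℝ 1 μ ⊔ Lp.LpSubmodule ℝ ℝ ∞ μ

/-- The linear maps from `L^1(ν) ∩ L^∞(ν)` to `L^1(μ) + L^∞(μ)`. -/
abbrev OpSpace {M N : Type*} [MeasurableSpace M] [MeasurableSpace N]
    (μ : Measure M) (ν : Measure N) : Type _ :=
  InterSpace ν →ₗ[ℝ] SumSpace μ

/-- The bounded operators from `L^∞(ν)` to `L^∞(μ)`, with the operator norm. -/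
abbrev B0 {M N : Type*} [MeasurableSpace M] [MeasurableSpace N]
    (μ : Measure M) (ν : Measure N) : Type _ :=
  Lp ℝ ∞ ν →L[ℝ] Lp ℝ ∞ μ

/-- The bounded operators from `L^1(ν)` to `L^1(μ)`, with the operator norm. -/
abbrev B1 {M N : Type*} [MeasurableSpace M] [MeasurableSpace N]
    (μ : Measure M) (ν : Measure N) : Type _ :=
  Lp ℝ 1 ν →L[ℝ] Lp ℝ 1 μ

/-- The linear map from `L^1(ν) ∩ L^∞(ν)` to `L^1(μ) + L^∞(μ)` induced by an element of `B0`. -/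
def ofB0 {M N : Type*} [MeasurableSpace M] [MeasurableSpace N]
    (μ : Measure M) (ν : Measure N) : B0 μ ν →ₗ[ℝ] OpSpace μ ν where
  toFun b :=
    { toFun := fun f => ⟨(b ⟨f.1, f.2.2⟩ : Lp ℝ ∞ μ).1,
        Submodule.mem_sup_right (b ⟨f.1, f.2.2⟩ : Lp ℝ ∞ μ).2⟩
      map_add' := fun f g => Subtype.ext
        (congrArg (fun g : Lp ℝ ∞ μ => (g : M →ₘ[μ] ℝ)) (b.map_add ⟨f.1, f.2.2⟩ ⟨g.1, g.2.2⟩))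
      map_smul' := fun c f => Subtype.ext
        (congrArg (fun g : Lp ℝ ∞ μ => (g : M →ₘ[μ] ℝ)) (b.map_smul c ⟨f.1, f.2.2⟩)) }
  map_add' _ _ := rfl
  map_smul' _ _ := rfl

/-- The linear map from `L^1(ν) ∩ L^∞(ν)` to `L^1(μ) + L^∞(μ)` induced by an element of `B1`. -/
def ofB1 {M N : Type*} [MeasurableSpace M] [MeasurableSpace N]
    (μ : Measure M) (ν : Measure N) : B1 μ ν →ₗ[ℝ] OpSpace μ ν where
  toFun b :=
    { toFun := fun f => ⟨(b ⟨f.1, f.2.1⟩ : Lp ℝ 1 μ).1,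
        Submodule.mem_sup_left (b ⟨f.1, f.2.1⟩ : Lp ℝ 1 μ).2⟩
      map_add' := fun f g => Subtype.ext
        (congrArg (fun g : Lp ℝ 1 μ => (g : M →ₘ[μ] ℝ)) (b.map_add ⟨f.1, f.2.1⟩ ⟨g.1, g.2.1⟩))
      map_smul' := fun c f => Subtype.ext
        (congrArg (fun g : Lp ℝ 1 μ => (g : M →ₘ[μ] ℝ)) (b.map_smul c ⟨f.1, f.2.1⟩)) }
  map_add' _ _ := rfl
  map_smul' _ _ := rfl

/-- The sum `B0 + B1`, formed inside the linear maps from `L^1(ν) ∩ L^∞(ν)` to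
`L^1(μ) + L^∞(μ)`. -/
def sumB {M N : Type*} [MeasurableSpace M] [MeasurableSpace N]
    (μ : Measure M) (ν : Measure N) : Submodule ℝ (OpSpace μ ν) :=
  LinearMap.range (ofB0 μ ν) ⊔ LinearMap.range (ofB1 μ ν)

/-- The functional `K_t(u; B0, B1)`: the infimum of `‖b₀‖ + t ‖b₁‖` over `b₀` in `B0` and
`b₁` in `B1` with `u = b₀ + b₁` on `L^1(ν) ∩ L^∞(ν)`. -/
def Kfun {M N : Type*} [MeasurableSpace M] [MeasurableSpace N]
    (μ : Measure M) (ν : Measure N) (t : ℝ) (u : OpSpace μ ν) : ℝ≥0∞ :=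
  ⨅ (b₀ : B0 μ ν) (b₁ : B1 μ ν) (_ : u = ofB0 μ ν b₀ + ofB1 μ ν b₁),
    ENNReal.ofReal (‖b₀‖ + t * ‖b₁‖)

/-- The order on operators: `v ≤ w` when `w - v` maps nonnegative functions to nonnegative
functions. -/
def OpLE {M N : Type*} [MeasurableSpace M] [MeasurableSpace N]
    {μ : Measure M} {ν : Measure N} (v w : OpSpace μ ν) : Prop :=
  ∀ f : InterSpace ν, (0 : N →ₘ[ν] ℝ) ≤ f.1 → (v f).1 ≤ (w f).1

/-- `v` is the modulus `|u|` of `u`, that is, the least upper bound of `u` and `-u`. -/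
structure IsModulus {M N : Type*} [MeasurableSpace M] [MeasurableSpace N]
    {μ : Measure M} {ν : Measure N} (u v : OpSpace μ ν) : Prop where
  le : OpLE u v
  neg_le : OpLE (-u) v
  least : ∀ w : OpSpace μ ν, OpLE u w → OpLE (-u) w → OpLE v w

theorem memLp_charFn {N : Type*} [MeasurableSpace N] {ν : Measure N} {F : Set N}
    (hF : MeasurableSet F) (hν : ν F < ∞) (p : ℝ≥0∞) :
    MemLp (F.indicator fun _ => (1 : ℝ)) p ν :=
  memLp_indicator_const p hF 1 (Or.inr hν.ne)

/-- The characteristic function of a measurable set of finite measure, as an element of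
`L^1(ν) ∩ L^∞(ν)`. -/
def charFn {N : Type*} [MeasurableSpace N] {ν : Measure N} {F : Set N}
    (hF : MeasurableSet F) (hν : ν F < ∞) : InterSpace ν :=
  ⟨AEEqFun.mk (F.indicator fun _ => (1 : ℝ)) (memLp_charFn hF hν 1).1,
    ⟨((memLp_charFn hF hν 1).toLp _).2, ((memLp_charFn hF hν ∞).toLp _).2⟩⟩

/-- The pairing `⟨g, 1_E⟩` of a nonnegative function `g` in `L^1(μ) + L^∞(μ)` with the
characteristic function of `E`. -/
def pairing {M : Type*} [MeasurableSpace M] {μ : Measure M} (g : SumSpace μ) (E : Set M) : ℝ≥0∞ :=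
  ∫⁻ x in E, ENNReal.ofReal (g.1 x) ∂μ

/-- The supremum of `(μ(E) ∨ t⁻¹ ν(F))⁻¹ ⟨v(1_F), 1_E⟩` over all measurable `E`, `F` of positive
finite measure, for a positive operator `v` (the supremum over the empty family being `0`). -/
def supFun {M N : Type*} [MeasurableSpace M] [MeasurableSpace N]
    {μ : Measure M} {ν : Measure N} (t : ℝ) (v : OpSpace μ ν) : ℝ≥0∞ :=
  ⨆ (E : Set M) (F : Set N) (_ : MeasurableSet E) (hF : MeasurableSet F)
    (_ : 0 < μ E) (_ : μ E < ∞) (_ : 0 < ν F) (hν : ν F < ∞),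
    (max (μ E) (ENNReal.ofReal t⁻¹ * ν F))⁻¹ * pairing (v (charFn hF hν)) E

end OpInterp

end

/-! Both inequalities compare `u` with what its modulus does to rectangles `E × F`.

Upper bound for the supremum. An operator between `L^1` spaces is order bounded: for `|g| ≤ f` all
`|b₁ g|` lie below one `h` with `‖h‖ ≤ ‖b₁‖ ‖f‖` (`exists_abs_apply_le_of_B1`). So if `u = b₀ + b₁`,
then `|u| 1_F ≤ ‖b₀‖ + h` with `‖h‖ ≤ ‖b₁‖ ν(F)`, and integration over `E` gives `‖b₀‖ μ(E) + ‖b₁‖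
ν(F)`. The same order bound makes the Riesz-Kantorovich formula produce the modulus.

Lower bound. Let `C` be the supremum and `C' = C / t`, so that `∫_E |u| 1_F ≤ C μ(E) + C' ν(F)`. It
suffices to write `u = b₀ + b₁` with `‖b₀‖ ≤ C` and `‖b₁‖ ≤ C'`; then `‖b₀‖ + t ‖b₁‖ ≤ 2C`, which is
the source of the factor `1/2`. On formal step functions `ψ = ∑ 1_E φ_E` put `U ψ = ∑ ∫_E u φ_E`.
The key estimate (`IsSupModulus.stepIntegral_le`) is `U ψ ≤ C ∫ ‖ψ(x)‖_∞ dμ + C' ‖f‖_1` whenever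
`|ψ(x)| ≤ f` for all `x`. Indeed `|ψ(x)| ≤ min(f, g(x))` with `g(x) = ‖ψ(x)‖_∞`, and up to an error
`min(f, δ)` this minimum is at most `δ` times the sum over `i` of the indicators of `{g > (i+1)δ} ×
{f > (i+1)δ}`. Each of these is a rectangle to which the hypothesis applies; then `δ → 0`.

Hahn-Banach splits `U` into a functional bounded in `L^1(μ; L^∞(ν))` and one bounded in `L^1(ν;
L^∞(μ))`. By duality over a localizable measure the first is an operator `b₀`
(`exists_B0_of_functional`); the bound on the second says that `u - b₀` is bounded in `L^1` norm, so
it extends to `b₁` (`IsSupModulus.exists_decomposition`). -/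

namespace OpInterp

/-! ### Vector lattices of measurable functions, ideals, Dedekind completeness. -/

section Order

variable {α : Type*} [MeasurableSpace α] {μ : Measure α}

instance aeEqFun_isOrderedAddMonoid : IsOrderedAddMonoid (α →ₘ[μ] ℝ) where
  add_le_add_left a b h c := by
    rw [← AEEqFun.coeFn_le] at h ⊢
    filter_upwards [h, AEEqFun.coeFn_add a c, AEEqFun.coeFn_add b c] with x hx h1 h2
    rw [h1, h2]
    simpa using hx

instance aeEqFun_posSMulMono : PosSMulMono ℝ (α →ₘ[μ] ℝ) where
  smul_le_smul_of_nonneg_left c hc a b h := by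
    rw [← AEEqFun.coeFn_le] at h ⊢
    filter_upwards [h, AEEqFun.coeFn_smul c a, AEEqFun.coeFn_smul c b] with x hx h1 h2
    rw [h1, h2]
    simpa using mul_le_mul_of_nonneg_left hx hc

theorem lattice_abs_le {L : Type*} [AddCommGroup L] [Lattice L] [IsOrderedAddMonoid L]
    {a b : L} : |a| ≤ b ↔ -b ≤ a ∧ a ≤ b := by
  rw [abs_le', and_comm, neg_le]

/-- In a lattice ordered group, an element dominated by a sum of two positive elements splits
into two dominated parts. -/
theorem exists_add_of_abs_le_add {L : Type*} [AddCommGroup L] [Lattice L] [IsOrderedAddMonoid L]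
    {g p q : L} (hp : 0 ≤ p) (hq : 0 ≤ q) (h : |g| ≤ p + q) :
    ∃ g₁ g₂ : L, g = g₁ + g₂ ∧ |g₁| ≤ p ∧ |g₂| ≤ q := by
  obtain ⟨h1, h2⟩ := lattice_abs_le.1 h
  -- The first part is `g` clamped to the order interval `[-p, p]`.
  refine ⟨(g ⊓ p) ⊔ (-p), g - ((g ⊓ p) ⊔ (-p)), by abel, lattice_abs_le.2 ⟨le_sup_right, ?_⟩,
    lattice_abs_le.2 ⟨?_, ?_⟩⟩
  · exact sup_le inf_le_right ((neg_nonpos.2 hp).trans hp)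
  · rw [neg_le_sub_iff_le_add]
    refine sup_le (inf_le_left.trans (le_add_of_nonneg_right hq)) ?_
    have := add_le_add_left h1 q
    have e : -(p + q) + q = -p := by abel
    rwa [e] at this
  · rw [sub_le_iff_le_add]
    have : g - q ≤ (g ⊓ p) ⊔ (-p) :=
      le_sup_of_le_left (le_inf (sub_le_self _ hq) (by rwa [sub_le_iff_le_add]))
    rw [sub_le_iff_le_add] at this
    rwa [add_comm]

/-- Solid submodules of a vector lattice (ideals). -/
def IsSolid {L : Type*} [AddCommGroup L] [Lattice L] [Module ℝ L] (X : Submodule ℝ L) : Prop :=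
  ∀ ⦃f g : L⦄, f ∈ X → |g| ≤ |f| → g ∈ X

theorem isSolid_lpSubmodule (p : ℝ≥0∞) : IsSolid (Lp.LpSubmodule ℝ ℝ p μ) := by
  intro f g hf h
  have hf' : f ∈ Lp ℝ p μ := hf
  refine (Lp.mem_Lp_of_ae_le (g := ⟨f, hf'⟩) ?_ : g ∈ Lp ℝ p μ)
  rw [← AEEqFun.coeFn_le] at h
  filter_upwards [h, AEEqFun.coeFn_abs g, AEEqFun.coeFn_abs f] with x hx h1 h2
  rw [h1, h2] at hx
  simpa using hx

theorem IsSolid.inf {L : Type*} [AddCommGroup L] [Lattice L] [Module ℝ L] {X Y : Submodule ℝ L}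
    (hX : IsSolid X) (hY : IsSolid Y) : IsSolid (X ⊓ Y) :=
  fun _ _ hf h => ⟨hX hf.1 h, hY hf.2 h⟩

theorem IsSolid.sup {L : Type*} [AddCommGroup L] [Lattice L] [IsOrderedAddMonoid L] [Module ℝ L]
    {X Y : Submodule ℝ L} (hX : IsSolid X) (hY : IsSolid Y) : IsSolid (X ⊔ Y) := by
  intro f g hf h
  obtain ⟨a, ha, b, hb, rfl⟩ := Submodule.mem_sup.1 hf
  obtain ⟨g₁, g₂, rfl, h1, h2⟩ := exists_add_of_abs_le_add (abs_nonneg a) (abs_nonneg b)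
    (h.trans (abs_add_le a b))
  exact Submodule.add_mem_sup (hX ha h1) (hY hb h2)

theorem isSolid_interSpace : IsSolid (InterSpace μ) :=
  (isSolid_lpSubmodule 1).inf (isSolid_lpSubmodule ∞)

theorem isSolid_sumSpace : IsSolid (SumSpace μ) :=
  (isSolid_lpSubmodule 1).sup (isSolid_lpSubmodule ∞)

/-- If `L^∞(μ)` is Dedekind complete, then so is the lattice of all measurable functions. -/
theorem exists_isLUB_aeEqFun (hμ : LinftyDedekindComplete μ) {S : Set (α →ₘ[μ] ℝ)}
    (hne : S.Nonempty) (hbdd : BddAbove S) : ∃ g, IsLUB S g := by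
  -- The arctangent embeds the order of all measurable functions into that of bounded ones.
  have hmem : ∀ s : α →ₘ[μ] ℝ, MemLp (fun x => Real.arctan (s x)) ∞ μ := fun s =>
    memLp_top_of_bound (Real.continuous_arctan.comp_aestronglyMeasurable s.aestronglyMeasurable)
      (Real.pi / 2) (Filter.Eventually.of_forall fun x => by
        rw [Real.norm_eq_abs, abs_le]
        exact ⟨(Real.neg_pi_div_two_lt_arctan _).le, (Real.arctan_lt_pi_div_two _).le⟩)
  let A : (α →ₘ[μ] ℝ) → Lp ℝ ∞ μ := fun s => (hmem s).toLp _
  have hA : ∀ s, A s =ᵐ[μ] fun x => Real.arctan (s x) := fun s => (hmem s).coeFn_toLp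
  have hmono : ∀ {s t : α →ₘ[μ] ℝ}, s ≤ t → A s ≤ A t := by
    intro s t h
    rw [← Lp.coeFn_le]
    rw [← AEEqFun.coeFn_le] at h
    filter_upwards [h, hA s, hA t] with x hx h1 h2
    rw [h1, h2]
    exact Real.arctan_strictMono.monotone hx
  obtain ⟨w, hw⟩ := hbdd
  obtain ⟨s₀, hs₀⟩ := hne
  obtain ⟨H, hH⟩ := hμ (A '' S) ⟨_, s₀, hs₀, rfl⟩
    ⟨A w, by rintro _ ⟨s, hs, rfl⟩; exact hmono (hw hs)⟩
  have hub : ∀ s ∈ S, A s ≤ H := fun s hs => hH.1 ⟨s, hs, rfl⟩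
  have hleast : ∀ t ∈ upperBounds S, H ≤ A t := fun t ht => hH.2 (by
    rintro _ ⟨s, hs, rfl⟩; exact hmono (ht hs))
  have htan : Measurable Real.tan := by
    have : Real.tan = fun x => Real.sin x / Real.cos x := funext Real.tan_eq_sin_div_cos
    rw [this]
    exact Real.measurable_sin.div Real.measurable_cos
  let h : α →ₘ[μ] ℝ := AEEqFun.compMeasurable Real.tan htan H.1
  -- `H` lies between `arctan s₀` and `arctan w`, hence strictly inside `(-π/2, π/2)`, where the
  -- tangent inverts the arctangent.
  have hh : ∀ᵐ x ∂μ, (H : α → ℝ) x = Real.arctan (h x) := by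
    filter_upwards [AEEqFun.coeFn_compMeasurable Real.tan htan H.1, hA s₀, hA w,
      (Lp.coeFn_le _ _).2 (hub s₀ hs₀), (Lp.coeFn_le _ _).2 (hleast w hw)] with x h1 h2 h3 h4 h5
    rw [h2] at h4
    rw [h3] at h5
    have : h x = Real.tan ((H : α → ℝ) x) := h1
    rw [this, Real.arctan_tan ((Real.neg_pi_div_two_lt_arctan _).trans_le h4)
      (h5.trans_lt (Real.arctan_lt_pi_div_two _))]
  refine ⟨h, fun s hs => ?_, fun t ht => ?_⟩
  · rw [← AEEqFun.coeFn_le]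
    filter_upwards [hh, hA s, (Lp.coeFn_le _ _).2 (hub s hs)] with x h1 h2 h3
    rw [h1, h2] at h3
    exact Real.arctan_strictMono.le_iff_le.1 h3
  · rw [← AEEqFun.coeFn_le]
    filter_upwards [hh, hA t, (Lp.coeFn_le _ _).2 (hleast t ht)] with x h1 h2 h3
    rw [h1, h2] at h3
    exact Real.arctan_strictMono.le_iff_le.1 h3

end Order

/-! ### The Riesz-Kantorovich construction of the modulus. -/

section RieszKantorovich

/-- A map that is additive and homogeneous on the positive cone of an ideal `X` agrees on that cone
with a linear map. -/
theorem exists_linearMap_of_additive {L V : Type*} [AddCommGroup L] [Lattice L]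
    [IsOrderedAddMonoid L] [Module ℝ L] [PosSMulMono ℝ L] [AddCommGroup V] [Module ℝ V]
    {X : Submodule ℝ L} (hX : IsSolid X) (m : X → V)
    (hadd : ∀ f g : X, (0 : L) ≤ f → (0 : L) ≤ g → m (f + g) = m f + m g)
    (hsmul : ∀ (c : ℝ) (f : X), 0 ≤ c → (0 : L) ≤ f → m (c • f) = c • m f) :
    ∃ v : X →ₗ[ℝ] V, ∀ f : X, (0 : L) ≤ f → v f = m f := by
  have hpos : ∀ f : X, (f : L)⁺ ∈ X := fun f =>
    hX f.2 (by rw [abs_of_nonneg (posPart_nonneg _)]; exact sup_le (le_abs_self _) (abs_nonneg _))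
  have hneg : ∀ f : X, (f : L)⁻ ∈ X := fun f =>
    hX f.2 (by rw [abs_of_nonneg (negPart_nonneg _)]; exact sup_le (neg_le_abs _) (abs_nonneg _))
  let P : X → X := fun f => ⟨_, hpos f⟩
  let Q : X → X := fun f => ⟨_, hneg f⟩
  have hP : ∀ f, (0 : L) ≤ P f := fun f => posPart_nonneg _
  have hQ : ∀ f, (0 : L) ≤ Q f := fun f => negPart_nonneg _
  have hPQ : ∀ f, f = P f - Q f := fun f => Subtype.ext (posPart_sub_negPart (f : L)).symm
  -- The difference `m a - m b` depends only on `a - b`, so each linearity claim may use whichever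
  -- decomposition is convenient.
  have key : ∀ f a b : X, (0 : L) ≤ a → (0 : L) ≤ b → f = a - b →
      m (P f) - m (Q f) = m a - m b := by
    intro f a b ha hb h
    have h1 : P f + b = a + Q f := by
      have := (hPQ f).symm.trans h
      rw [sub_eq_sub_iff_add_eq_add] at this
      exact this
    have h2 := congrArg m h1
    rw [hadd _ _ (hP f) hb, hadd _ _ ha (hQ f)] at h2
    rw [sub_eq_sub_iff_add_eq_add, h2]
  have hkadd : ∀ f g : X, m (P (f + g)) - m (Q (f + g)) =
      (m (P f) - m (Q f)) + (m (P g) - m (Q g)) := by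
    intro f g
    rw [key (f + g) (P f + P g) (Q f + Q g) (add_nonneg (hP f) (hP g)) (add_nonneg (hQ f) (hQ g))
      (by conv_lhs => rw [hPQ f, hPQ g]
          abel), hadd _ _ (hP f) (hP g), hadd _ _ (hQ f) (hQ g)]
    abel
  have hksmul : ∀ (c : ℝ) (f : X), 0 ≤ c →
      m (P (c • f)) - m (Q (c • f)) = c • (m (P f) - m (Q f)) := by
    intro c f hc
    rw [key (c • f) (c • P f) (c • Q f) (smul_nonneg hc (hP f)) (smul_nonneg hc (hQ f))
      (by conv_lhs => rw [hPQ f, smul_sub]), hsmul _ _ hc (hP f), hsmul _ _ hc (hQ f), smul_sub]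
  have hkneg : ∀ f : X, m (P (-f)) - m (Q (-f)) = -(m (P f) - m (Q f)) := by
    intro f
    rw [key (-f) (Q f) (P f) (hQ f) (hP f) (by conv_lhs => rw [hPQ f]
                                               abel), neg_sub]
  refine ⟨{ toFun := fun f => m (P f) - m (Q f), map_add' := hkadd, map_smul' := ?_ }, ?_⟩
  · intro c f
    rcases le_total 0 c with hc | hc
    · exact hksmul c f hc
    · have h := hksmul (-c) (-f) (neg_nonneg.2 hc)
      rw [neg_smul_neg] at h
      rw [h, hkneg]
      simp only [neg_smul, smul_neg, neg_neg, RingHom.id_apply]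
  · intro f hf
    have h0 : m 0 = 0 := by
      have := hsmul 0 0 le_rfl le_rfl
      simpa using this
    have h := key f f 0 hf le_rfl (by simp)
    change m (P f) - m (Q f) = m f
    rw [h, h0, sub_zero]

/-- The Riesz-Kantorovich theorem: an order bounded linear map `u` into an ideal of a Dedekind
complete vector lattice has a modulus, given by `|u| f = sup {u g : |g| ≤ f}` for `f ≥ 0`. -/
theorem exists_modulus_of_orderBounded {L L' : Type*} [AddCommGroup L] [Lattice L]
    [IsOrderedAddMonoid L] [Module ℝ L] [PosSMulMono ℝ L]
    [AddCommGroup L'] [Lattice L'] [IsOrderedAddMonoid L'] [Module ℝ L'] [PosSMulMono ℝ L']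
    {X : Submodule ℝ L} (hX : IsSolid X) {Y : Submodule ℝ L'} (hY : IsSolid Y)
    (hDC : ∀ S : Set L', S.Nonempty → BddAbove S → ∃ g, IsLUB S g) (u : X →ₗ[ℝ] Y)
    (hu : ∀ f : X, (0 : L) ≤ f → ∃ w ∈ Y, ∀ g : X, |(g : L)| ≤ f → (u g : L') ≤ w) :
    ∃ v : X →ₗ[ℝ] Y, ∀ f : X, (0 : L) ≤ f →
      IsLUB {y : L' | ∃ g : X, |(g : L)| ≤ f ∧ (u g : L') = y} (v f) := by
  -- Off the positive cone the value is an irrelevant default. On it, the supremum lies in `Y`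
  -- because it is between `0` and `w` and `Y` is solid.
  have hex : ∀ f : X, ∃ y : Y, (0 : L) ≤ f →
      IsLUB {y : L' | ∃ g : X, |(g : L)| ≤ f ∧ (u g : L') = y} y := by
    intro f
    by_cases hf : (0 : L) ≤ f
    · obtain ⟨w, hwY, hw⟩ := hu f hf
      obtain ⟨y, hy⟩ := hDC {y : L' | ∃ g : X, |(g : L)| ≤ f ∧ (u g : L') = y}
        ⟨u 0, 0, by simpa using hf, rfl⟩ ⟨w, by rintro _ ⟨g, hg, rfl⟩; exact hw g hg⟩
      have h0 : 0 ≤ y := hy.1 ⟨0, by simpa using hf, by simp⟩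
      have h1 : y ≤ w := hy.2 (by rintro _ ⟨g, hg, rfl⟩; exact hw g hg)
      exact ⟨⟨y, hY hwY (by rwa [abs_of_nonneg h0, abs_of_nonneg (h0.trans h1)])⟩, fun _ => hy⟩
    · exact ⟨0, fun h => absurd h hf⟩
  choose m hm using hex
  suffices h : (∀ f g : X, (0 : L) ≤ f → (0 : L) ≤ g → m (f + g) = m f + m g) ∧
      ∀ (c : ℝ) (f : X), 0 ≤ c → (0 : L) ≤ f → m (c • f) = c • m f by
    obtain ⟨v, hv⟩ := exists_linearMap_of_additive hX m h.1 h.2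
    exact ⟨v, fun f hf => by rw [hv f hf]; exact hm f hf⟩
  refine ⟨?_, ?_⟩
  · intro f g hf hg
    refine Subtype.ext ((hm (f + g) (add_nonneg hf hg)).unique ?_)
    refine ⟨?_, ?_⟩
    · rintro _ ⟨a, ha, rfl⟩
      obtain ⟨a₁, a₂, h, h1, h2⟩ := exists_add_of_abs_le_add hf hg ha
      have m1 : a₁ ∈ X := hX f.2 (h1.trans (le_abs_self _))
      have m2 : a₂ ∈ X := hX g.2 (h2.trans (le_abs_self _))
      have : a = ⟨a₁, m1⟩ + ⟨a₂, m2⟩ := Subtype.ext h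
      rw [this, map_add]
      exact add_le_add ((hm f hf).1 ⟨⟨a₁, m1⟩, h1, rfl⟩) ((hm g hg).1 ⟨⟨a₂, m2⟩, h2, rfl⟩)
    · intro y hy
      have hfg : ∀ a : X, |(a : L)| ≤ f → ∀ b : X, |(b : L)| ≤ g → (u a : L') + u b ≤ y :=
        fun a ha b hb => hy ⟨a + b, (abs_add_le _ _).trans (add_le_add ha hb), by simp⟩
      have h1 : ∀ a : X, |(a : L)| ≤ f → (m g : L') ≤ y - u a := fun a ha =>
        (hm g hg).2 (by rintro _ ⟨b, hb, rfl⟩; rw [le_sub_iff_add_le']; exact hfg a ha b hb)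
      have h2 : (m f : L') ≤ y - m g := (hm f hf).2 (by
        rintro _ ⟨a, ha, rfl⟩
        have := h1 a ha
        rw [le_sub_iff_add_le] at this ⊢
        rwa [add_comm])
      rw [le_sub_iff_add_le] at h2
      exact h2
  · intro c f hc hf
    -- For `c > 0` both inequalities come from rescaling by `c` and `c⁻¹`, so `c = 0` is treated
    -- apart.
    rcases hc.eq_or_lt with rfl | hc
    · have := hm ((0 : ℝ) • f) (by simp)
      refine Subtype.ext (this.unique ?_)
      refine ⟨?_, fun y hy => ?_⟩
      · rintro _ ⟨a, ha, rfl⟩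
        have : a = 0 := by
          rw [zero_smul] at ha
          have ha' := lattice_abs_le.1 ha
          exact Subtype.ext (le_antisymm ha'.2 (by simpa using ha'.1))
        simp [this]
      · exact hy ⟨0, by simp, by simp⟩
    · refine Subtype.ext ((hm (c • f) (smul_nonneg hc.le hf)).unique ?_)
      have habs : ∀ (d : ℝ) (a : L), 0 ≤ d → |d • a| ≤ d • |a| := fun d a hd =>
        lattice_abs_le.2 ⟨by rw [← smul_neg]; exact smul_le_smul_of_nonneg_left (neg_le.1 (neg_le_abs a)) hd,
          smul_le_smul_of_nonneg_left (le_abs_self a) hd⟩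
      refine ⟨?_, fun y hy => ?_⟩
      · rintro _ ⟨a, ha, rfl⟩
        have h1 : (u (c⁻¹ • a) : L') ≤ m f := (hm f hf).1 ⟨c⁻¹ • a, by
          refine (habs _ _ (inv_nonneg.2 hc.le)).trans ?_
          refine (smul_le_smul_of_nonneg_left ha (inv_nonneg.2 hc.le)).trans ?_
          simp [smul_smul, inv_mul_cancel₀ hc.ne'], rfl⟩
        have h2 := smul_le_smul_of_nonneg_left h1 hc.le
        simpa [smul_smul, mul_inv_cancel₀ hc.ne'] using h2
      · have h1 : (m f : L') ≤ c⁻¹ • y := (hm f hf).2 (by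
          rintro _ ⟨a, ha, rfl⟩
          have h2 : c • (u a : L') ≤ y := hy ⟨c • a, (habs c a hc.le).trans
            (smul_le_smul_of_nonneg_left ha hc.le), by simp⟩
          have h3 := smul_le_smul_of_nonneg_left h2 (inv_nonneg.2 hc.le)
          rwa [smul_smul, inv_mul_cancel₀ hc.ne', one_smul] at h3)
        have h2 := smul_le_smul_of_nonneg_left h1 hc.le
        rw [smul_smul, mul_inv_cancel₀ hc.ne', one_smul] at h2
        exact h2

end RieszKantorovich

/-! ### Order boundedness of operators between `L^1` spaces. -/

section Bounds

variable {M N : Type*} [MeasurableSpace M] [MeasurableSpace N] {μ : Measure M} {ν : Measure N}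

/-- The norm of `L^1` is additive on the positive cone. -/
theorem norm_sub_eq_of_le {a b : Lp ℝ 1 μ} (ha : 0 ≤ a) (hab : a ≤ b) : ‖b - a‖ = ‖b‖ - ‖a‖ := by
  rw [L1.norm_eq_integral_norm, L1.norm_eq_integral_norm, L1.norm_eq_integral_norm,
    ← integral_sub (L1.integrable_coeFn b).norm (L1.integrable_coeFn a).norm]
  refine integral_congr_ae ?_
  filter_upwards [Lp.coeFn_sub b a, (Lp.coeFn_nonneg a).2 ha, (Lp.coeFn_le a b).2 hab]
    with x h1 h2 h3
  simp only [Pi.zero_apply] at h2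
  rw [h1, Pi.sub_apply, Real.norm_of_nonneg (sub_nonneg.2 h3), Real.norm_of_nonneg h2,
    Real.norm_of_nonneg (h2.trans h3)]

/-- `L^1` is a KB-space: a norm bounded upward directed family of positive elements is bounded
above, with the same norm bound. -/
theorem exists_upperBound_of_directed {D : Set (Lp ℝ 1 μ)} (hne : D.Nonempty)
    (hpos : ∀ d ∈ D, 0 ≤ d) (hdir : DirectedOn (· ≤ ·) D) {K : ℝ} (hK : ∀ d ∈ D, ‖d‖ ≤ K) :
    ∃ h : Lp ℝ 1 μ, ‖h‖ ≤ K ∧ ∀ d ∈ D, d ≤ h := by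
  have : Nonempty D := hne.to_subtype
  have : IsDirectedOrder D := ⟨directedOn_iff_directed.1 hdir⟩
  have hbdd : BddAbove (Set.range fun d : D => ‖d.1‖) := ⟨K, by rintro _ ⟨d, rfl⟩; exact hK d d.2⟩
  have hC : Cauchy (Filter.map (Subtype.val : D → Lp ℝ 1 μ) Filter.atTop) := by
    rw [Metric.cauchy_iff]
    refine ⟨inferInstance, fun ε hε => ?_⟩
    -- Beyond an element whose norm is within `ε / 2` of the supremum of the norms, additivity of
    -- the norm turns small norm increments into small distances.
    obtain ⟨d₀, hd₀⟩ := exists_lt_of_lt_ciSup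
      (show (⨆ d : D, ‖d.1‖) - ε / 2 < ⨆ d : D, ‖d.1‖ by linarith)
    have key : ∀ d : D, d₀ ≤ d → dist d.1 d₀.1 < ε / 2 := by
      intro d hd
      rw [dist_eq_norm, norm_sub_eq_of_le (hpos _ d₀.2) hd]
      have := le_ciSup hbdd d
      linarith
    refine ⟨Subtype.val '' Set.Ici d₀, Filter.image_mem_map (Filter.Ici_mem_atTop d₀), ?_⟩
    rintro _ ⟨x, hx, rfl⟩ _ ⟨y, hy, rfl⟩
    have h1 := key x hx
    have h2 := key y hy
    have h3 := dist_triangle_right x.1 y.1 d₀.1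
    linarith
  obtain ⟨h, hh⟩ := CompleteSpace.complete hC
  have ht : Filter.Tendsto (Subtype.val : D → Lp ℝ 1 μ) Filter.atTop (nhds h) := hh
  refine ⟨h, le_of_tendsto ht.norm (Filter.Eventually.of_forall fun d => hK d d.2),
    fun d hd => ge_of_tendsto ht ?_⟩
  filter_upwards [Filter.Ici_mem_atTop (⟨d, hd⟩ : D)] with e he
  exact he

theorem norm_le_norm_of_le {E : Type*} [NormedAddCommGroup E] [Lattice E] [HasSolidNorm E]
    [IsOrderedAddMonoid E] {a b : E} (ha : 0 ≤ a) (hab : a ≤ b) : ‖a‖ ≤ ‖b‖ :=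
  norm_le_norm_of_abs_le_abs (by rwa [abs_of_nonneg ha, abs_of_nonneg (ha.trans hab)])

/-- A bounded operator between `L^1` spaces is bounded, with the same norm, from `L^1(ℓ^∞)`
to `L^1(ℓ^∞)`. -/
theorem norm_sup_abs_le {ι : Type*} [Fintype ι] [Nonempty ι] (b : B1 μ ν) (a : Lp (ι → ℝ) 1 ν) :
    ‖Finset.univ.sup' Finset.univ_nonempty
      (fun i : ι => |b ((ContinuousLinearMap.proj (R := ℝ) (φ := fun _ : ι => ℝ) i).compLpL 1 ν a)|)‖
      ≤ ‖b‖ * ‖a‖ := by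
  set π : ι → Lp (ι → ℝ) 1 ν →L[ℝ] Lp ℝ 1 ν :=
    fun i => (ContinuousLinearMap.proj (R := ℝ) (φ := fun _ : ι => ℝ) i).compLpL 1 ν with hπ
  have hnn : ∀ a : Lp (ι → ℝ) 1 ν,
      0 ≤ Finset.univ.sup' Finset.univ_nonempty (fun i : ι => |b (π i a)|) := fun a =>
    (abs_nonneg _).trans
      (Finset.le_sup' (fun i : ι => |b (π i a)|) (Finset.mem_univ (Classical.arbitrary ι)))
  change ‖Finset.univ.sup' Finset.univ_nonempty (fun i : ι => |b (π i a)|)‖ ≤ ‖b‖ * ‖a‖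
  -- For `1_s c` every coordinate is a multiple of `b 1_s`, so the bound is immediate. It passes to
  -- sums with disjoint supports, where the norms on the right add up exactly, and then to limits.
  refine Lp.induction (by simp) (motive := fun a =>
    ‖Finset.univ.sup' Finset.univ_nonempty (fun i : ι => |b (π i a)|)‖ ≤ ‖b‖ * ‖a‖) ?_ ?_ ?_ a
  · intro c s hs hνs
    rw [Lp.simpleFunc.coe_indicatorConst]
    have h1 : ∀ i, π i (indicatorConstLp 1 hs hνs.ne c) =
        c i • indicatorConstLp 1 hs hνs.ne (1 : ℝ) := by
      intro i
      refine Lp.ext ?_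
      filter_upwards [ContinuousLinearMap.coeFn_compLpL (p := 1) (μ := ν)
        (ContinuousLinearMap.proj (R := ℝ) (φ := fun _ : ι => ℝ) i)
        (indicatorConstLp 1 hs hνs.ne c), indicatorConstLp_coeFn (p := 1) (hs := hs)
          (hμs := hνs.ne) (c := c), indicatorConstLp_coeFn (p := 1) (hs := hs)
          (hμs := hνs.ne) (c := (1 : ℝ)), Lp.coeFn_smul (c i)
          (indicatorConstLp 1 hs hνs.ne (1 : ℝ))] with x h1 h2 h3 h4
      rw [h1, h2, h4, Pi.smul_apply, h3]
      by_cases hx : x ∈ s <;> simp [hx]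
    have h2 : Finset.univ.sup' Finset.univ_nonempty
        (fun i : ι => |b (π i (indicatorConstLp 1 hs hνs.ne c))|) ≤
        ‖c‖ • |b (indicatorConstLp 1 hs hνs.ne (1 : ℝ))| := by
      refine Finset.sup'_le _ _ fun i _ => ?_
      rw [h1, map_smul, ← Lp.coeFn_le]
      filter_upwards [Lp.coeFn_abs (c i • b (indicatorConstLp 1 hs hνs.ne (1 : ℝ))),
        Lp.coeFn_smul (c i) (b (indicatorConstLp 1 hs hνs.ne (1 : ℝ))),
        Lp.coeFn_abs (b (indicatorConstLp 1 hs hνs.ne (1 : ℝ))),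
        Lp.coeFn_smul ‖c‖ |b (indicatorConstLp 1 hs hνs.ne (1 : ℝ))|] with x e1 e2 e3 e4
      rw [e1, e2, e4, Pi.smul_apply, Pi.smul_apply, e3, smul_eq_mul, smul_eq_mul, abs_mul]
      exact mul_le_mul_of_nonneg_right (norm_le_pi_norm c i) (abs_nonneg _)
    refine (norm_le_norm_of_le (hnn _) h2).trans ?_
    rw [norm_smul, norm_norm, norm_abs_eq_norm]
    have h3 := b.le_opNorm (indicatorConstLp 1 hs hνs.ne (1 : ℝ))
    rw [norm_indicatorConstLp (by simp) (by simp)] at h3 ⊢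
    rw [norm_one, one_mul] at h3
    calc _ ≤ ‖c‖ * (‖b‖ * ν.real s ^ (1 / (1 : ℝ≥0∞).toReal)) :=
          mul_le_mul_of_nonneg_left h3 (norm_nonneg _)
      _ = _ := by ring
  · intro f g hf hg hdisj h1 h2
    have h3 : Finset.univ.sup' Finset.univ_nonempty
        (fun i : ι => |b (π i (hf.toLp f + hg.toLp g))|) ≤
        Finset.univ.sup' Finset.univ_nonempty (fun i : ι => |b (π i (hf.toLp f))|) +
        Finset.univ.sup' Finset.univ_nonempty (fun i : ι => |b (π i (hg.toLp g))|) := by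
      refine Finset.sup'_le _ _ fun i hi => ?_
      rw [map_add, map_add]
      exact (abs_add_le _ _).trans (add_le_add
        (Finset.le_sup' (fun i : ι => |b (π i (hf.toLp f))|) hi)
        (Finset.le_sup' (fun i : ι => |b (π i (hg.toLp g))|) hi))
    have h4 : ‖hf.toLp f + hg.toLp g‖ = ‖hf.toLp f‖ + ‖hg.toLp g‖ := by
      rw [L1.norm_eq_integral_norm, L1.norm_eq_integral_norm, L1.norm_eq_integral_norm,
        ← integral_add (L1.integrable_coeFn _).norm (L1.integrable_coeFn _).norm]
      refine integral_congr_ae ?_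
      filter_upwards [Lp.coeFn_add (hf.toLp f) (hg.toLp g), hf.coeFn_toLp, hg.coeFn_toLp]
        with x e1 e2 e3
      rw [e1, Pi.add_apply, e2, e3]
      by_cases hx : f x = 0
      · simp [hx]
      · have : g x = 0 := by
          by_contra hgx
          exact Set.disjoint_left.1 hdisj hx hgx
        simp [this]
    refine (norm_le_norm_of_le (hnn _) h3).trans ((norm_add_le _ _).trans ?_)
    rw [h4, mul_add]
    exact add_le_add h1 h2
  · refine isClosed_le (Continuous.norm (Continuous.finset_sup'_apply _ fun i _ => ?_))
      (continuous_const.mul continuous_norm)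
    have hc := b.continuous.comp (π i).continuous
    exact hc.sup hc.neg

/-- The family `g` is one function with values in `ℓ^∞`, whose norm is at most `f` at almost every
point; the constant is therefore independent of the number of functions. -/
theorem norm_sup_abs_apply_le {ι : Type*} [Fintype ι] [Nonempty ι] (b : B1 μ ν) {f : Lp ℝ 1 ν}
    (g : ι → Lp ℝ 1 ν) (hg : ∀ i, |g i| ≤ f) :
    ‖Finset.univ.sup' Finset.univ_nonempty (fun i : ι => |b (g i)|)‖ ≤ ‖b‖ * ‖f‖ := by
  have hmem : MemLp (fun x (i : ι) => (g i : N → ℝ) x) 1 ν := MemLp.of_eval fun i => Lp.memLp (g i)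
  have h2 := norm_sup_abs_le b (hmem.toLp _)
  have h3 : ∀ i : ι, (ContinuousLinearMap.proj (R := ℝ) (φ := fun _ : ι => ℝ) i).compLpL 1 ν
      (hmem.toLp _) = g i := by
    intro i
    refine Lp.ext ?_
    filter_upwards [ContinuousLinearMap.coeFn_compLpL (p := 1) (μ := ν)
      (ContinuousLinearMap.proj (R := ℝ) (φ := fun _ : ι => ℝ) i) (hmem.toLp _),
      hmem.coeFn_toLp] with x e1 e2
    rw [e1, e2]
    rfl
  simp only [h3] at h2
  refine h2.trans (mul_le_mul_of_nonneg_left ?_ (norm_nonneg _))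
  refine Lp.norm_le_norm_of_ae_le ?_
  have h5 : ∀ᵐ x ∂ν, ∀ i : ι, |(g i : N → ℝ) x| ≤ f x := by
    rw [ae_all_iff]
    intro i
    filter_upwards [(Lp.coeFn_le _ _).2 (hg i), Lp.coeFn_abs (g i)] with x e1 e2
    rwa [e2] at e1
  filter_upwards [h5, hmem.coeFn_toLp] with x e1 e2
  rw [e2]
  exact (pi_norm_le_iff_of_nonneg (norm_nonneg _)).2 fun i => (e1 i).trans (le_abs_self _)

theorem sup'_univ_subtype {ι L : Type*} [SemilatticeSup L] (s : Finset ι) (hs : s.Nonempty)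
    [Nonempty s] (F : ι → L) :
    s.sup' hs F = Finset.univ.sup' Finset.univ_nonempty (fun i : s => F i.1) :=
  le_antisymm (Finset.sup'_le _ _ fun g hg =>
      Finset.le_sup' (fun i : s => F i.1) (Finset.mem_univ ⟨g, hg⟩))
    (Finset.sup'_le _ _ fun i _ => Finset.le_sup' F i.2)

/-- A bounded operator between `L^1` spaces is order bounded. -/
theorem exists_abs_apply_le_of_B1 (b : B1 μ ν) {f : Lp ℝ 1 ν} (hf : 0 ≤ f) :
    ∃ h : Lp ℝ 1 μ, ‖h‖ ≤ ‖b‖ * ‖f‖ ∧ ∀ g : Lp ℝ 1 ν, |g| ≤ f → |b g| ≤ h := by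
  classical
  -- Finite suprema of the `|b g|` form an upward directed family, bounded in norm by `‖b‖ ‖f‖`; its
  -- limit is the required bound.
  let D : Set (Lp ℝ 1 μ) := {d | ∃ (s : Finset (Lp ℝ 1 ν)) (hs : s.Nonempty),
    (∀ g ∈ s, |g| ≤ f) ∧ s.sup' hs (fun g => |b g|) = d}
  have hsing : ∀ g : Lp ℝ 1 ν, |g| ≤ f → |b g| ∈ D := fun g hg =>
    ⟨{g}, Finset.singleton_nonempty g, by simpa using hg, by simp⟩
  suffices hD : (∀ d ∈ D, 0 ≤ d) ∧ DirectedOn (· ≤ ·) D ∧ ∀ d ∈ D, ‖d‖ ≤ ‖b‖ * ‖f‖ by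
    obtain ⟨h, h1, h2⟩ := exists_upperBound_of_directed ⟨_, hsing 0 (by simpa using hf)⟩
      hD.1 hD.2.1 hD.2.2
    exact ⟨h, h1, fun g hg => h2 _ (hsing g hg)⟩
  refine ⟨?_, ?_, ?_⟩
  · rintro _ ⟨s, ⟨g, hg⟩, -, rfl⟩
    exact (abs_nonneg _).trans (Finset.le_sup' (fun g => |b g|) hg)
  · rintro _ ⟨s, hs, h1, rfl⟩ _ ⟨s', hs', h1', rfl⟩
    refine ⟨_, ⟨s ∪ s', hs.mono Finset.subset_union_left, ?_, rfl⟩,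
      Finset.sup'_mono _ Finset.subset_union_left _,
      Finset.sup'_mono _ Finset.subset_union_right _⟩
    intro g hg
    rcases Finset.mem_union.1 hg with h | h
    exacts [h1 g h, h1' g h]
  · rintro _ ⟨s, hs, h1, rfl⟩
    have : Nonempty s := hs.to_subtype
    rw [sup'_univ_subtype s hs (fun g => |b g|)]
    exact norm_sup_abs_apply_le b (fun i : s => i.1) fun i => h1 i.1 i.2

theorem ae_abs_le_norm (g : Lp ℝ ∞ μ) : ∀ᵐ x ∂μ, |(g : M → ℝ) x| ≤ ‖g‖ := by
  filter_upwards [ae_le_eLpNormEssSup (f := (g : M → ℝ)) (μ := μ)] with x hx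
  have h1 : ‖(g : M → ℝ) x‖ₑ ≤ ‖g‖ₑ := by
    rw [Lp.enorm_def, eLpNorm_exponent_top]
    exact hx
  exact (enorm_le_iff_norm_le).1 h1

/-- The inclusion of `L^1 ∩ L^∞` in `L^1`. -/
def toL1 (ν : Measure N) : InterSpace ν →ₗ[ℝ] Lp ℝ 1 ν where
  toFun f := ⟨f.1, f.2.1⟩
  map_add' _ _ := rfl
  map_smul' _ _ := rfl

/-- The inclusion of `L^1 ∩ L^∞` in `L^∞`. -/
def toLinf (ν : Measure N) : InterSpace ν →ₗ[ℝ] Lp ℝ ∞ ν where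
  toFun f := ⟨f.1, f.2.2⟩
  map_add' _ _ := rfl
  map_smul' _ _ := rfl

/-- An element of `B0 + B1` is order bounded, with control of the two parts of the bound. -/
theorem exists_apply_le_of_sum (b₀ : B0 μ ν) (b₁ : B1 μ ν) {f : InterSpace ν}
    (hf : (0 : N →ₘ[ν] ℝ) ≤ f) :
    ∃ h : Lp ℝ 1 μ, ‖h‖ ≤ ‖b₁‖ * ‖toL1 ν f‖ ∧ ∀ g : InterSpace ν, |(g : N →ₘ[ν] ℝ)| ≤ f →
      ((ofB0 μ ν b₀ + ofB1 μ ν b₁) g : M →ₘ[μ] ℝ) ≤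
        AEEqFun.const M (‖b₀‖ * ‖toLinf ν f‖) + h.1 := by
  obtain ⟨h, h1, h2⟩ := exists_abs_apply_le_of_B1 b₁ (f := toL1 ν f) hf
  refine ⟨h, h1, fun g hg => ?_⟩
  refine add_le_add (a := (b₀ (toLinf ν g)).1) (c := (b₁ (toL1 ν g)).1) ?_ ?_
  · rw [← AEEqFun.coeFn_le]
    filter_upwards [ae_abs_le_norm (b₀ (toLinf ν g)),
      AEEqFun.coeFn_const M (μ := μ) (‖b₀‖ * ‖toLinf ν f‖)] with x e1 e2
    rw [e2]
    refine (le_abs_self _).trans (e1.trans ((b₀.le_opNorm _).trans ?_))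
    refine mul_le_mul_of_nonneg_left ?_ (norm_nonneg _)
    refine norm_le_norm_of_abs_le_abs (?_ : |toLinf ν g| ≤ |toLinf ν f|)
    have hf' : 0 ≤ toLinf ν f := hf
    rw [abs_of_nonneg hf']
    exact hg
  · exact (le_abs_self (b₁ (toL1 ν g))).trans (h2 _ hg)

end Bounds

/-! ### Densities in `L^∞` over a localizable measure. -/

section Duality

variable {M : Type*} [MeasurableSpace M] {μ : Measure M}

/-- Over a semifinite measure, a property that holds almost everywhere on every set of finite
measure holds almost everywhere. -/
theorem IsSemifinite.ae_of_forall_restrict (hμ : IsSemifinite μ) {p : M → Prop}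
    (hp : MeasurableSet {x | p x})
    (h : ∀ E : Set M, MeasurableSet E → μ E < ∞ → ∀ᵐ x ∂μ.restrict E, p x) : ∀ᵐ x ∂μ, p x := by
  have key : ∀ E : Set M, MeasurableSet E → μ E < ∞ → E ⊆ {x | ¬ p x} → μ E = 0 := by
    intro E hE hfin hsub
    have h1 := h E hE hfin
    rw [ae_restrict_iff' hE] at h1
    exact measure_mono_null (fun x hx => fun h2 => hsub hx (h2 hx)) h1
  by_contra hcon
  have hpos : μ {x | ¬ p x} ≠ 0 := hcon
  rcases eq_or_ne (μ {x | ¬ p x}) ∞ with htop | htop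
  · obtain ⟨B, hB, hBm, hB0, hB1⟩ := hμ _ hp.compl htop
    exact hB0.ne' (key B hBm hB1 hB)
  · exact hpos (key _ hp.compl (lt_top_iff_ne_top.2 htop) subset_rfl)

theorem linf_norm_le {g : Lp ℝ ∞ μ} {C : ℝ} (hC : 0 ≤ C) (h : ∀ᵐ x ∂μ, ‖g x‖ ≤ C) : ‖g‖ ≤ C := by
  rw [Lp.norm_def, eLpNorm_exponent_top]
  exact ENNReal.toReal_le_of_le_ofReal hC (eLpNormEssSup_le_of_ae_bound h)

theorem integrableOn_linf (h : Lp ℝ ∞ μ) {E : Set M} (hE : μ E < ∞) :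
    IntegrableOn (h : M → ℝ) E μ :=
  have : IsFiniteMeasure (μ.restrict E) := ⟨by simpa using hE⟩
  ((Lp.memLp h).restrict E).integrable le_top

/-- Uniqueness of densities; it makes the density depend linearly on the data in
`exists_B0_of_functional`. -/
theorem linf_ext_of_setIntegral_eq (hμ : IsSemifinite μ) {g h : Lp ℝ ∞ μ}
    (hgh : ∀ E : Set M, MeasurableSet E → μ E < ∞ → ∫ x in E, g x ∂μ = ∫ x in E, h x ∂μ) :
    g = h := by
  refine Lp.ext (hμ.ae_of_forall_restrict
    (measurableSet_eq_fun (Lp.stronglyMeasurable g).measurable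
      (Lp.stronglyMeasurable h).measurable) fun E hE hfin => ?_)
  refine Integrable.ae_eq_of_forall_setIntegral_eq _ _ (integrableOn_linf g hfin)
    (integrableOn_linf h hfin) fun A hA _ => ?_
  rw [Measure.restrict_restrict hA]
  exact hgh _ (hA.inter hE) ((measure_mono Set.inter_subset_right).trans_lt hfin)

/-- A finitely additive set function dominated by a multiple of `μ` is countably additive. -/
theorem hasSum_of_abs_le {β : Set M → ℝ} {C : ℝ}
    (hadd : ∀ A B : Set M, MeasurableSet A → MeasurableSet B → μ A < ∞ → μ B < ∞ → Disjoint A B →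
      β (A ∪ B) = β A + β B)
    (hbd : ∀ A : Set M, MeasurableSet A → μ A < ∞ → |β A| ≤ C * μ.real A)
    {f : ℕ → Set M} (hf : ∀ i, MeasurableSet (f i)) (hd : Pairwise (Function.onFun Disjoint f))
    (hfin : μ (⋃ i, f i) < ∞) : HasSum (fun i => β (f i)) (β (⋃ i, f i)) := by
  have hsub : ∀ A ⊆ ⋃ i, f i, μ A < ∞ := fun A hA => (measure_mono hA).trans_lt hfin
  have hsum : ∑' i, μ (f i) ≠ ∞ := by rw [← measure_iUnion hd hf]; exact hfin.ne
  have hsummable : Summable fun i => β (f i) := by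
    refine Summable.of_norm_bounded (g := fun i => C * μ.real (f i))
      ((ENNReal.summable_toReal hsum).mul_left C) fun i => ?_
    exact hbd _ (hf i) (hsub _ (Set.subset_iUnion f i))
  -- Finite additivity leaves the error `β (R n)` after `n` terms, and domination by `C μ(R n)`
  -- sends it to zero.
  let R : ℕ → Set M := fun n => ⋃ i, f (i + n)
  have hRm : ∀ n, MeasurableSet (R n) := fun n => MeasurableSet.iUnion fun i => hf _
  have hRsub : ∀ n, R n ⊆ ⋃ i, f i := fun n =>
    Set.iUnion_subset fun i => Set.subset_iUnion f (i + n)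
  have hRsucc : ∀ n, R n = f n ∪ R (n + 1) := by
    intro n
    refine Set.Subset.antisymm (Set.iUnion_subset fun i => ?_) (Set.union_subset ?_ ?_)
    · cases i with
      | zero => simp
      | succ k =>
        refine Set.subset_union_of_subset_right ?_ _
        rw [add_right_comm, add_assoc]
        exact Set.subset_iUnion (fun i => f (i + (n + 1))) k
    · have := Set.subset_iUnion (fun i => f (i + n)) 0
      simpa using this
    · refine Set.iUnion_subset fun i => ?_
      have := Set.subset_iUnion (fun i => f (i + n)) (i + 1)
      rwa [add_right_comm, add_assoc] at this
  have hpart : ∀ n, β (⋃ i, f i) = ∑ i ∈ Finset.range n, β (f i) + β (R n) := by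
    intro n
    induction n with
    | zero => simp [R]
    | succ k ih =>
      rw [ih, hRsucc k, hadd _ _ (hf k) (hRm _) (hsub _ (Set.subset_iUnion f k))
        (hsub _ (hRsub _)), Finset.sum_range_succ, add_assoc]
      refine Set.disjoint_iUnion_right.2 fun i => hd ?_
      omega
  have hR0 : Filter.Tendsto (fun n => β (R n)) Filter.atTop (nhds 0) := by
    have h1 : Filter.Tendsto (fun n => μ (R n)) Filter.atTop (nhds 0) :=
      tendsto_of_tendsto_of_tendsto_of_le_of_le tendsto_const_nhds
        (ENNReal.tendsto_sum_nat_add _ hsum) (fun _ => zero_le) fun n => measure_iUnion_le _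
    have h2 := ((ENNReal.tendsto_toReal ENNReal.zero_ne_top).comp h1).const_mul C
    refine squeeze_zero_norm (fun n => ?_) (by simpa using h2)
    exact hbd _ (hRm n) (hsub _ (hRsub n))
  rw [hsummable.hasSum_iff_tendsto_nat]
  have h3 : (fun n => ∑ i ∈ Finset.range n, β (f i)) = fun n => β (⋃ i, f i) - β (R n) :=
    funext fun n => by rw [hpart n]; ring
  rw [h3]
  simpa using hR0.const_sub (β (⋃ i, f i))

/-- The density, on a set of finite measure, of a set function dominated by a multiple
of `μ`. -/
theorem exists_local_density {β : Set M → ℝ} {C : ℝ}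
    (hadd : ∀ A B : Set M, MeasurableSet A → MeasurableSet B → μ A < ∞ → μ B < ∞ → Disjoint A B →
      β (A ∪ B) = β A + β B)
    (hbd : ∀ A : Set M, MeasurableSet A → μ A < ∞ → |β A| ≤ C * μ.real A)
    {E : Set M} (hE : MeasurableSet E) (hfin : μ E < ∞) :
    ∃ h : M → ℝ, Measurable h ∧ (∀ᵐ x ∂μ.restrict E, |h x| ≤ C) ∧
      ∀ A ⊆ E, MeasurableSet A → ∫ x in A, h x ∂μ = β A := by
  classical
  have hsub : ∀ A : Set M, μ (A ∩ E) < ∞ := fun A =>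
    (measure_mono Set.inter_subset_right).trans_lt hfin
  have : IsFiniteMeasure (μ.restrict E) := ⟨by simpa using hfin⟩
  -- Radon-Nikodym is applied to the trace of `β` on `E`; a signed measure must vanish on
  -- nonmeasurable sets.
  let s : SignedMeasure M :=
    { measureOf' := fun A => if MeasurableSet A then β (A ∩ E) else 0
      empty' := by
        have := hbd ∅ MeasurableSet.empty (by simp)
        simpa using this
      not_measurable' := fun A hA => by simp [hA]
      m_iUnion' := fun f hf hd => by
        simp only [hf, MeasurableSet.iUnion hf, if_true]
        rw [Set.iUnion_inter]
        refine hasSum_of_abs_le hadd hbd (fun i => (hf i).inter hE)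
          (fun i j hij => (hd hij).mono Set.inter_subset_left Set.inter_subset_left) ?_
        rw [← Set.iUnion_inter]
        exact hsub _ }
  have hs : ∀ A, MeasurableSet A → s A = β (A ∩ E) := fun A hA => if_pos hA
  have hreal : ∀ A, MeasurableSet A → (μ.restrict E).real A = μ.real (A ∩ E) := fun A hA => by
    rw [measureReal_restrict_apply hA]
  have hac : s ≪ᵥ (μ.restrict E).toENNRealVectorMeasure := by
    refine VectorMeasure.AbsolutelyContinuous.mk fun A hA h0 => ?_
    rw [Measure.toENNRealVectorMeasure_apply_measurable hA, Measure.restrict_apply hA] at h0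
    have h1 := hbd _ (hA.inter hE) (hsub A)
    rw [measureReal_def, h0, ENNReal.toReal_zero, mul_zero] at h1
    rw [hs A hA]
    exact abs_nonpos_iff.1 h1
  have hrn := SignedMeasure.withDensityᵥ_rnDeriv_eq s (μ.restrict E) hac
  have hint : Integrable (s.rnDeriv (μ.restrict E)) (μ.restrict E) :=
    SignedMeasure.integrable_rnDeriv _ _
  have hval : ∀ A, MeasurableSet A →
      ∫ x in A, s.rnDeriv (μ.restrict E) x ∂μ.restrict E = β (A ∩ E) := by
    intro A hA
    rw [← withDensityᵥ_apply hint hA, hrn, hs A hA]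
  refine ⟨s.rnDeriv (μ.restrict E), SignedMeasure.measurable_rnDeriv _ _, ?_, ?_⟩
  · have h1 : s.rnDeriv (μ.restrict E) ≤ᵐ[μ.restrict E] fun _ => C := by
      refine ae_le_of_forall_setIntegral_le hint (integrable_const C) fun A hA _ => ?_
      rw [hval A hA, setIntegral_const, hreal A hA, smul_eq_mul, mul_comm]
      exact (le_abs_self _).trans (hbd _ (hA.inter hE) (hsub A))
    have h2 : (fun _ => -C) ≤ᵐ[μ.restrict E] s.rnDeriv (μ.restrict E) := by
      refine ae_le_of_forall_setIntegral_le (integrable_const (-C)) hint fun A hA _ => ?_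
      rw [hval A hA, setIntegral_const, hreal A hA, smul_eq_mul, mul_neg, mul_comm]
      exact neg_le_of_abs_le (hbd _ (hA.inter hE) (hsub A))
    filter_upwards [h1, h2] with x e1 e2
    exact abs_le.2 ⟨e2, e1⟩
  · intro A hAE hA
    have := hval A hA
    rwa [Measure.restrict_restrict hA, Set.inter_eq_left.2 hAE] at this

/-- Over a localizable measure, a finitely additive set function on the sets of finite measure
that is dominated by a multiple of `μ` has a density in `L^∞(μ)`. -/
theorem exists_linf_density (hμ : IsLocalizable μ) {β : Set M → ℝ} {C : ℝ} (hC : 0 ≤ C)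
    (hadd : ∀ A B : Set M, MeasurableSet A → MeasurableSet B → μ A < ∞ → μ B < ∞ → Disjoint A B →
      β (A ∪ B) = β A + β B)
    (hbd : ∀ A : Set M, MeasurableSet A → μ A < ∞ → |β A| ≤ C * μ.real A) :
    ∃ h : Lp ℝ ∞ μ, ‖h‖ ≤ C ∧
      ∀ E : Set M, MeasurableSet E → μ E < ∞ → ∫ x in E, h x ∂μ = β E := by
  classical
  let ι := {E : Set M // MeasurableSet E ∧ μ E < ∞}
  have hloc : ∀ E : ι, ∃ h : M → ℝ, Measurable h ∧ (∀ᵐ x ∂μ, x ∈ E.1 → |h x| ≤ C) ∧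
      ∀ A ⊆ E.1, MeasurableSet A → ∫ x in A, h x ∂μ = β A := by
    rintro ⟨E, hE, hfin⟩
    obtain ⟨h, h1, h2, h3⟩ := exists_local_density hadd hbd hE hfin
    exact ⟨h, h1, (ae_restrict_iff' hE).1 h2, h3⟩
  choose k hkm hkb hki using hloc
  have hcompat : ∀ E E' : ι, ∀ᵐ x ∂μ, x ∈ E.1 → x ∈ E'.1 → k E x = k E' x := by
    intro E E'
    have hm := E.2.1.inter E'.2.1
    have hfin : μ (E.1 ∩ E'.1) < ∞ := (measure_mono Set.inter_subset_left).trans_lt E.2.2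
    have : IsFiniteMeasure (μ.restrict (E.1 ∩ E'.1)) := ⟨by simpa using hfin⟩
    have hint : ∀ G : ι, E.1 ∩ E'.1 ⊆ G.1 → Integrable (k G) (μ.restrict (E.1 ∩ E'.1)) := by
      intro G hG
      refine Integrable.of_bound (hkm G).aestronglyMeasurable C ?_
      rw [ae_restrict_iff' hm]
      filter_upwards [hkb G] with x hx hxm
      exact hx (hG hxm)
    have h1 := Integrable.ae_eq_of_forall_setIntegral_eq _ _ (hint E Set.inter_subset_left)
      (hint E' Set.inter_subset_right) fun A hA _ => by
        rw [Measure.restrict_restrict hA,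
          hki E _ (Set.inter_subset_right.trans Set.inter_subset_left) (hA.inter hm),
          hki E' _ (Set.inter_subset_right.trans Set.inter_subset_right) (hA.inter hm)]
    filter_upwards [(ae_restrict_iff' hm).1 h1] with x hx h2 h3 using hx ⟨h2, h3⟩
  -- Adding `C` makes the local densities nonnegative, so extending them by zero outside `E` does
  -- not spoil their supremum. The constant is subtracted again at the end.
  have hgm : ∀ E : ι, MemLp (E.1.indicator fun x => k E x + C) ∞ μ := by
    intro E
    refine memLp_top_of_bound
      (((hkm E).add_const C).indicator E.2.1).aestronglyMeasurable (2 * C) ?_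
    filter_upwards [hkb E] with x hx
    by_cases hxE : x ∈ E.1
    · have := abs_le.1 (hx hxE)
      rw [Set.indicator_of_mem hxE, Real.norm_of_nonneg (by linarith)]
      linarith
    · rw [Set.indicator_of_notMem hxE, norm_zero]
      linarith
  have hcm : MemLp (fun _ : M => 2 * C) ∞ μ :=
    memLp_top_of_bound aestronglyMeasurable_const (2 * C)
      (Filter.Eventually.of_forall fun _ => (Real.norm_of_nonneg (by linarith)).le)
  let G : ι → Lp ℝ ∞ μ := fun E => (hgm E).toLp _
  have hG : ∀ E, G E =ᵐ[μ] E.1.indicator fun x => k E x + C := fun E => (hgm E).coeFn_toLp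
  let E₀ : ι := ⟨∅, MeasurableSet.empty, by simp⟩
  have hub : hcm.toLp _ ∈ upperBounds (Set.range G) := by
    rintro _ ⟨E, rfl⟩
    rw [← Lp.coeFn_le]
    filter_upwards [hG E, hcm.coeFn_toLp, hkb E] with x e1 e2 e3
    rw [e1, e2]
    by_cases hxE : x ∈ E.1
    · rw [Set.indicator_of_mem hxE]
      linarith [(abs_le.1 (e3 hxE)).2]
    · rw [Set.indicator_of_notMem hxE]
      linarith
  obtain ⟨H, hH⟩ := hμ.dedekindComplete (Set.range G) ⟨_, E₀, rfl⟩ ⟨_, hub⟩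
  have hH0 : ∀ᵐ x ∂μ, 0 ≤ H x := by
    filter_upwards [hG E₀, (Lp.coeFn_le _ _).2 (hH.1 ⟨E₀, rfl⟩)] with x e1 e2
    rw [e1] at e2
    simpa [E₀] using e2
  have hHC : ∀ᵐ x ∂μ, H x ≤ 2 * C := by
    filter_upwards [hcm.coeFn_toLp, (Lp.coeFn_le _ _).2 (hH.2 hub)] with x e1 e2
    rwa [e1] at e2
  -- Replacing `H` on `E` by the shifted local density leaves an upper bound, since local densities
  -- agree on overlaps. As `H` is least, it cannot exceed that density on `E`.
  have hHE : ∀ E : ι, ∀ᵐ x ∂μ, x ∈ E.1 → H x = k E x + C := by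
    intro E
    have hm' : MemLp (E.1.piecewise (fun x => k E x + C) H) ∞ μ := by
      refine memLp_top_of_bound (AEStronglyMeasurable.piecewise E.2.1
        ((hkm E).add_const C).aestronglyMeasurable
        (Lp.aestronglyMeasurable H).restrict) (2 * C) ?_
      filter_upwards [hkb E, hH0, hHC] with x e1 e2 e3
      by_cases hxE : x ∈ E.1
      · have := abs_le.1 (e1 hxE)
        rw [Set.piecewise_eq_of_mem _ _ _ hxE, Real.norm_of_nonneg (by linarith)]
        linarith
      · rw [Set.piecewise_eq_of_notMem _ _ _ hxE, Real.norm_of_nonneg e2]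
        exact e3
    have hub' : hm'.toLp _ ∈ upperBounds (Set.range G) := by
      rintro _ ⟨E', rfl⟩
      rw [← Lp.coeFn_le]
      filter_upwards [hG E', hm'.coeFn_toLp, hkb E, hcompat E E',
        (Lp.coeFn_le _ _).2 (hH.1 ⟨E', rfl⟩)] with x e1 e2 e3 e4 e5
      rw [e2]
      by_cases hxE : x ∈ E.1
      · rw [Set.piecewise_eq_of_mem _ _ _ hxE, e1]
        by_cases hxE' : x ∈ E'.1
        · rw [Set.indicator_of_mem hxE', e4 hxE hxE']
        · rw [Set.indicator_of_notMem hxE']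
          linarith [(abs_le.1 (e3 hxE)).1]
      · rw [Set.piecewise_eq_of_notMem _ _ _ hxE]
        exact e5
    filter_upwards [hG E, hm'.coeFn_toLp, (Lp.coeFn_le _ _).2 (hH.1 ⟨E, rfl⟩),
      (Lp.coeFn_le _ _).2 (hH.2 hub')] with x e1 e2 e3 e4 hxE
    rw [e1, Set.indicator_of_mem hxE] at e3
    rw [e2, Set.piecewise_eq_of_mem _ _ _ hxE] at e4
    exact le_antisymm e4 e3
  have hfm : MemLp (fun x => H x - C) ∞ μ := by
    refine memLp_top_of_bound ((Lp.aestronglyMeasurable H).sub aestronglyMeasurable_const) C ?_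
    filter_upwards [hH0, hHC] with x e1 e2
    rw [Real.norm_eq_abs, abs_le]
    exact ⟨by linarith, by linarith⟩
  refine ⟨hfm.toLp _, ?_, fun E hE hfin => ?_⟩
  · refine linf_norm_le hC ?_
    filter_upwards [hfm.coeFn_toLp, hH0, hHC] with x e0 e1 e2
    rw [e0, Real.norm_eq_abs, abs_le]
    exact ⟨by linarith, by linarith⟩
  · rw [← hki ⟨E, hE, hfin⟩ E subset_rfl hE]
    refine setIntegral_congr_ae hE ?_
    filter_upwards [hfm.coeFn_toLp, hHE ⟨E, hE, hfin⟩] with x e0 e1 hx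
    rw [e0, e1 hx]
    ring

end Duality

/-! ### The modulus of an element of `B0 + B1`. -/

section Modulus

variable {M N : Type*} [MeasurableSpace M] [MeasurableSpace N] {μ : Measure M} {ν : Measure N}

theorem integrableOn_sumSpace (g : SumSpace μ) {E : Set M} (hE : μ E < ∞) :
    IntegrableOn (g.1 : M → ℝ) E μ := by
  obtain ⟨a, ha, b, hb, hab⟩ := Submodule.mem_sup.1 g.2
  have h1 : IntegrableOn (a : M → ℝ) E μ := (L1.integrable_coeFn (⟨a, ha⟩ : Lp ℝ 1 μ)).integrableOn
  have h2 : IntegrableOn (b : M → ℝ) E μ := integrableOn_linf (⟨b, hb⟩ : Lp ℝ ∞ μ) hE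
  refine (h1.add h2).congr (ae_restrict_of_ae ?_)
  rw [← hab]
  exact (AEEqFun.coeFn_add a b).symm

/-- `v` is given by the Riesz-Kantorovich formula `v f = sup {u g : |g| ≤ f}` for `f ≥ 0`. -/
def IsSupModulus (u v : OpSpace μ ν) : Prop :=
  ∀ f : InterSpace ν, (0 : N →ₘ[ν] ℝ) ≤ f →
    IsLUB {y : M →ₘ[μ] ℝ | ∃ g : InterSpace ν, |(g : N →ₘ[ν] ℝ)| ≤ f ∧ (u g : M →ₘ[μ] ℝ) = y} (v f)

theorem exists_isSupModulus (hμ : LinftyDedekindComplete μ) {u : OpSpace μ ν}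
    (hu : u ∈ sumB μ ν) : ∃ v : OpSpace μ ν, IsSupModulus u v := by
  obtain ⟨_, ⟨b₀, rfl⟩, _, ⟨b₁, rfl⟩, rfl⟩ := Submodule.mem_sup.1 hu
  refine exists_modulus_of_orderBounded isSolid_interSpace isSolid_sumSpace
    (fun S hne hb => exists_isLUB_aeEqFun hμ hne hb) _ fun f hf => ?_
  obtain ⟨h, -, h2⟩ := exists_apply_le_of_sum b₀ b₁ hf
  refine ⟨_, ?_, h2⟩
  refine Submodule.add_mem _ (Submodule.mem_sup_right ?_) (Submodule.mem_sup_left h.2)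
  exact ((memLp_top_const (μ := μ) (‖b₀‖ * ‖toLinf ν f‖)).toLp _).2

namespace IsSupModulus

variable {u v : OpSpace μ ν}

theorem apply_le (h : IsSupModulus u v) {f g : InterSpace ν}
    (hg : |(g : N →ₘ[ν] ℝ)| ≤ f) : (u g : M →ₘ[μ] ℝ) ≤ v f :=
  (h f ((abs_nonneg _).trans hg)).1 ⟨g, hg, rfl⟩

theorem nonneg (h : IsSupModulus u v) {f : InterSpace ν} (hf : (0 : N →ₘ[ν] ℝ) ≤ f) :
    (0 : M →ₘ[μ] ℝ) ≤ v f := by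
  have := h.apply_le (f := f) (g := 0) (by simpa using hf)
  simpa using this

/-- For minimality: if `w` dominates `u` and `-u`, then `u g = u g⁺ - u g⁻ ≤ w g⁺ + w g⁻ = w |g| ≤ w
f` whenever `|g| ≤ f`, the last step because `w` is positive. -/
theorem isModulus (h : IsSupModulus u v) : IsModulus u v where
  le f hf := h.apply_le (by rw [abs_of_nonneg hf])
  neg_le f hf := by
    have := h.apply_le (f := f) (g := -f) (by simp [abs_of_nonneg hf])
    simpa using this
  least w h1 h2 f hf := by
    refine (h f hf).2 ?_
    rintro _ ⟨g, hg, rfl⟩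
    have mp : (g : N →ₘ[ν] ℝ)⁺ ∈ InterSpace ν := isSolid_interSpace g.2
      (by rw [abs_of_nonneg (posPart_nonneg _)]; exact sup_le (le_abs_self _) (abs_nonneg _))
    have mn : (g : N →ₘ[ν] ℝ)⁻ ∈ InterSpace ν := isSolid_interSpace g.2
      (by rw [abs_of_nonneg (negPart_nonneg _)]; exact sup_le (neg_le_abs _) (abs_nonneg _))
    have e1 := h1 ⟨_, mp⟩ (posPart_nonneg _)
    have e2 := h2 ⟨_, mn⟩ (negPart_nonneg _)
    -- Adding `u a ≤ w a` and `-u a ≤ w a` gives `0 ≤ 2 w a`.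
    have hpos : ∀ a : InterSpace ν, (0 : N →ₘ[ν] ℝ) ≤ a → (0 : M →ₘ[μ] ℝ) ≤ w a := by
      intro a ha
      have h3 := add_le_add (h1 a ha) (h2 a ha)
      have h4 : (u a).1 + ((-u) a).1 = 0 := by simp
      rw [h4, ← two_smul ℝ] at h3
      have h5 := smul_le_smul_of_nonneg_left h3 (by norm_num : (0 : ℝ) ≤ 2⁻¹)
      simpa [smul_smul] using h5
    have e3 : (u g : M →ₘ[μ] ℝ) = (u ⟨_, mp⟩).1 + ((-u) ⟨_, mn⟩).1 := by
      have : g = ⟨_, mp⟩ - ⟨_, mn⟩ := Subtype.ext (posPart_sub_negPart (g : N →ₘ[ν] ℝ)).symm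
      conv_lhs => rw [this, map_sub]
      simp [sub_eq_add_neg]
    have e4 : (w f : M →ₘ[μ] ℝ) = (w ⟨_, mp⟩).1 + (w ⟨_, mn⟩).1 +
        (w (f - (⟨_, mp⟩ + ⟨_, mn⟩))).1 := by
      rw [map_sub, map_add]
      simp
    rw [e3, e4]
    refine le_add_of_le_of_nonneg (add_le_add e1 e2) (hpos _ ?_)
    have : (g : N →ₘ[ν] ℝ)⁺ + (g : N →ₘ[ν] ℝ)⁻ ≤ f := by rwa [posPart_add_negPart]
    exact sub_nonneg.2 this

/-- With `f = 1_F` this is the upper bound on rectangles; with `f` a truncation it controls the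
error of the layer decomposition. -/
theorem setIntegral_le {b₀ : B0 μ ν} {b₁ : B1 μ ν}
    (h : IsSupModulus (ofB0 μ ν b₀ + ofB1 μ ν b₁) v) {f : InterSpace ν}
    (hf : (0 : N →ₘ[ν] ℝ) ≤ f) {E : Set M} (hE : μ E < ∞) :
    ∫ x in E, (v f).1 x ∂μ ≤
      ‖b₀‖ * ‖toLinf ν f‖ * μ.real E + ‖b₁‖ * ‖toL1 ν f‖ := by
  obtain ⟨k, h1, h2⟩ := exists_apply_le_of_sum b₀ b₁ hf
  have h3 : (v f : M →ₘ[μ] ℝ) ≤ AEEqFun.const M (‖b₀‖ * ‖toLinf ν f‖) + k.1 :=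
    (h f hf).2 (by rintro _ ⟨g, hg, rfl⟩; exact h2 g hg)
  have hconst : IntegrableOn (fun _ : M => ‖b₀‖ * ‖toLinf ν f‖) E μ :=
    integrableOn_const hE.ne
  have hk : Integrable (fun x => ‖(k : M → ℝ) x‖) μ := (L1.integrable_coeFn k).norm
  calc ∫ x in E, (v f).1 x ∂μ
      ≤ ∫ x in E, (‖b₀‖ * ‖toLinf ν f‖ + ‖(k : M → ℝ) x‖) ∂μ := by
        refine integral_mono_ae (integrableOn_sumSpace _ hE) (hconst.add hk.integrableOn)
          (ae_restrict_of_ae ?_)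
        filter_upwards [AEEqFun.coeFn_le.2 h3, AEEqFun.coeFn_add
          (AEEqFun.const M (‖b₀‖ * ‖toLinf ν f‖)) k.1,
          AEEqFun.coeFn_const M (μ := μ) (‖b₀‖ * ‖toLinf ν f‖)] with x e1 e2 e3
        rw [e2, Pi.add_apply, e3] at e1
        exact e1.trans (add_le_add le_rfl (le_abs_self _))
    _ = ‖b₀‖ * ‖toLinf ν f‖ * μ.real E + ∫ x in E, ‖(k : M → ℝ) x‖ ∂μ := by
        rw [integral_add hconst hk.integrableOn, setIntegral_const, smul_eq_mul, mul_comm]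
    _ ≤ _ := by
        refine add_le_add le_rfl (le_trans ?_ h1)
        rw [L1.norm_eq_integral_norm]
        exact setIntegral_le_integral hk (Filter.Eventually.of_forall fun x => norm_nonneg _)

end IsSupModulus

end Modulus

/-! ### Splitting a functional dominated by a sum. -/

section HahnBanach

/-- A linear functional dominated by the sum of two sublinear functionals splits accordingly. -/
theorem exists_linearMap_of_le_add_sublinear {S₀ S₁ : Type*} [AddCommGroup S₀] [Module ℝ S₀]
    [AddCommGroup S₁] [Module ℝ S₁] (j : S₁ →ₗ[ℝ] S₀) (U : S₁ →ₗ[ℝ] ℝ) (p₀ : S₀ → ℝ) (p₁ : S₁ → ℝ)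
    (hom₀ : ∀ c : ℝ, 0 < c → ∀ x, p₀ (c • x) = c * p₀ x)
    (add₀ : ∀ x y, p₀ (x + y) ≤ p₀ x + p₀ y)
    (hom₁ : ∀ c : ℝ, 0 < c → ∀ x, p₁ (c • x) = c * p₁ x)
    (add₁ : ∀ x y, p₁ (x + y) ≤ p₁ x + p₁ y)
    (hU : ∀ ψ, U ψ ≤ p₀ (j ψ) + p₁ ψ) :
    ∃ B : S₀ →ₗ[ℝ] ℝ, (∀ φ, B φ ≤ p₀ φ) ∧ ∀ ψ, U ψ - B (j ψ) ≤ p₁ ψ := by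
  -- On the product, `U` lives on the graph of `j`, where it is dominated by `p₀ + p₁`. Restricting
  -- the extension to the two factors gives the two pieces.
  obtain ⟨G, hG1, hG2⟩ := exists_extension_of_le_sublinear
    ((U.comp (LinearMap.snd ℝ S₀ S₁)).toPMap (LinearMap.range (j.prod LinearMap.id)))
    (fun x => p₀ x.1 + p₁ x.2)
    (fun c hc x => by
      rw [Prod.smul_fst, Prod.smul_snd, hom₀ c hc, hom₁ c hc, mul_add])
    (fun x y => by
      rw [Prod.fst_add, Prod.snd_add]
      linarith [add₀ x.1 y.1, add₁ x.2 y.2])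
    (by
      rintro ⟨_, ψ, rfl⟩
      exact hU ψ)
  have hz₀ : p₀ 0 = 0 := by
    have := hom₀ 2 (by norm_num) 0
    rw [smul_zero] at this
    linarith
  have hz₁ : p₁ 0 = 0 := by
    have := hom₁ 2 (by norm_num) 0
    rw [smul_zero] at this
    linarith
  refine ⟨G.comp (LinearMap.inl ℝ S₀ S₁), fun φ => ?_, fun ψ => ?_⟩
  · have := hG2 (φ, 0)
    simpa [hz₁] using this
  · have h1 : G (j ψ, ψ) = U ψ := hG1 ⟨_, ψ, rfl⟩
    have h2 : G (j ψ, ψ) = G (j ψ, 0) + G (0, ψ) := by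
      rw [← map_add]
      simp
    have h3 := hG2 (0, ψ)
    simp only [hz₀, zero_add] at h3
    have h4 : (G.comp (LinearMap.inl ℝ S₀ S₁)) (j ψ) = G (j ψ, 0) := rfl
    rw [h4]
    linarith

end HahnBanach

/-! ### Discrete layer cake inequalities for numbers. -/

section LayerCake

/-- At most `⌊r / δ⌋` thresholds `(i + 1) δ` lie below `r`. Starting the thresholds at `δ` rather
than `0` makes this a lower sum. -/
theorem mul_sum_levels_le {δ r : ℝ} (hδ : 0 < δ) (hr : 0 ≤ r) (K : ℕ) :
    δ * ∑ i ∈ Finset.range K, (if ((i : ℝ) + 1) * δ < r then (1 : ℝ) else 0) ≤ r := by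
  rw [Finset.sum_boole]
  have h1 : ((Finset.range K).filter fun i : ℕ => ((i : ℝ) + 1) * δ < r).card ≤ ⌊r / δ⌋₊ := by
    refine (Finset.card_le_card (t := Finset.range ⌊r / δ⌋₊) fun i hi => ?_).trans
      (Finset.card_range _).le
    rw [Finset.mem_filter] at hi
    rw [Finset.mem_range, ← Nat.succ_le_iff]
    refine Nat.le_floor ?_
    rw [le_div_iff₀ hδ]
    push_cast
    exact hi.2.le
  have h2 : (((Finset.range K).filter fun i : ℕ => ((i : ℝ) + 1) * δ < r).card : ℝ) ≤ r / δ :=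
    (Nat.cast_le.2 h1).trans (Nat.floor_le (by positivity))
  rw [le_div_iff₀ hδ] at h2
  linarith

/-- The lower sum for `min r (n δ)` falls short by at most one layer, which `min r δ` supplies. The
condition `i + 1 < n` later encodes a second level set, in the variable `x`. -/
theorem le_min_add_mul_sum_levels {δ r a : ℝ} (hδ : 0 < δ) {K n : ℕ} (hrK : r ≤ K * δ)
    (har : a ≤ r) (han : a ≤ n * δ) :
    a ≤ min r δ + δ * ∑ i ∈ Finset.range K,
      (if i + 1 < n then (if ((i : ℝ) + 1) * δ < r then (1 : ℝ) else 0) else 0) := by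
  have hsum : 0 ≤ ∑ i ∈ Finset.range K,
      (if i + 1 < n then (if ((i : ℝ) + 1) * δ < r then (1 : ℝ) else 0) else 0) :=
    Finset.sum_nonneg fun i _ => by split_ifs <;> norm_num
  rcases le_total r δ with h | h
  · rw [min_eq_left h]
    nlinarith
  · rw [min_eq_right h]
    -- The indices below `L - 1` pass both tests, and `a ≤ L δ`; for `L = 0` the truncated
    -- subtraction is harmless.
    set L := min n ⌈r / δ⌉₊ with hL
    have h1 : a ≤ L * δ := by
      rcases min_choice n ⌈r / δ⌉₊ with h2 | h2
      · rw [hL, h2]; exact han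
      · rw [hL, h2]
        refine har.trans ?_
        rw [← div_le_iff₀ hδ]
        exact Nat.le_ceil _
    have h2 : ((L - 1 : ℕ) : ℝ) ≤ ∑ i ∈ Finset.range K,
        (if i + 1 < n then (if ((i : ℝ) + 1) * δ < r then (1 : ℝ) else 0) else 0) := by
      have h3 : ∀ i ∈ Finset.range (L - 1), i + 1 < n ∧ ((i : ℝ) + 1) * δ < r := by
        intro i hi
        rw [Finset.mem_range] at hi
        have h4 : i + 1 < L := by omega
        refine ⟨h4.trans_le (min_le_left _ _), ?_⟩
        have h5 := Nat.lt_ceil.1 (h4.trans_le (min_le_right _ _))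
        rw [lt_div_iff₀ hδ] at h5
        exact_mod_cast h5
      have h4 : Finset.range (L - 1) ⊆ Finset.range K := by
        intro i hi
        have h5 := (h3 i hi).2.trans_le hrK
        rw [Finset.mem_range]
        have h6 : (i : ℝ) + 1 < K := lt_of_mul_lt_mul_right h5 hδ.le
        have h7 : i + 1 < K := by exact_mod_cast h6
        omega
      calc ((L - 1 : ℕ) : ℝ) = ∑ i ∈ Finset.range (L - 1), (1 : ℝ) := by simp
        _ = ∑ i ∈ Finset.range (L - 1),
            (if i + 1 < n then (if ((i : ℝ) + 1) * δ < r then (1 : ℝ) else 0) else 0) :=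
          Finset.sum_congr rfl fun i hi => by
            rw [if_pos (h3 i hi).1, if_pos (h3 i hi).2]
        _ ≤ _ := Finset.sum_le_sum_of_subset_of_nonneg h4 fun i _ _ => by split_ifs <;> norm_num
    have h3 : (L : ℝ) ≤ ((L - 1 : ℕ) : ℝ) + 1 := by
      have : L ≤ (L - 1) + 1 := by omega
      exact_mod_cast this
    nlinarith

end LayerCake

/-! ### Formal step functions and the functional attached to `u`. -/

noncomputable section StepFunctions

variable {M N : Type*} [MeasurableSpace M] [MeasurableSpace N] {μ : Measure M} {ν : Measure N}

/-- The measurable sets of finite measure. -/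
abbrev FinSet (μ : Measure M) : Type _ := {E : Set M // MeasurableSet E ∧ μ E < ∞}

open Classical in
/-- The value at `x` of the step function `∑ E, 1_E φ_E`. -/
def stepFun {V : Type*} [AddCommGroup V] [Module ℝ V] (x : M) : (FinSet μ →₀ V) →ₗ[ℝ] V :=
  Finsupp.lsum ℝ fun E => if x ∈ E.1 then LinearMap.id else 0

section

variable {V : Type*} [AddCommGroup V] [Module ℝ V]

theorem stepFun_apply (x : M) (φ : FinSet μ →₀ V) :
    stepFun x φ = ∑ E ∈ φ.support, E.1.indicator (fun _ => φ E) x := by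
  classical
  rw [stepFun, Finsupp.lsum_apply, Finsupp.sum]
  refine Finset.sum_congr rfl fun E _ => ?_
  by_cases hx : x ∈ E.1 <;> simp [hx]

theorem stepFun_single (x : M) (E : FinSet μ) (a : V) :
    stepFun x (Finsupp.single E a) = E.1.indicator (fun _ => a) x := by
  classical
  rw [stepFun, Finsupp.lsum_single]
  by_cases hx : x ∈ E.1 <;> simp [hx]

open Classical in
-- Every value is one of finitely many subset sums of the coefficients, so almost everywhere
-- statements about `u (stepFun x ψ)` involve only finitely many functions.
theorem stepFun_eq_sum_filter (x : M) (φ : FinSet μ →₀ V) :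
    stepFun x φ = ∑ E ∈ φ.support.filter (fun E => x ∈ E.1), φ E := by
  rw [stepFun_apply, Finset.sum_filter]
  rfl

theorem stepFun_mapRange {W : Type*} [AddCommGroup W] [Module ℝ W] (j : V →ₗ[ℝ] W) (x : M)
    (φ : FinSet μ →₀ V) : stepFun x (Finsupp.mapRange.linearMap j φ) = j (stepFun x φ) := by
  induction φ using Finsupp.induction_linear with
  | zero => simp
  | add f g hf hg => simp only [map_add, hf, hg]
  | single E a =>
    rw [Finsupp.mapRange.linearMap_apply, Finsupp.mapRange_single, stepFun_single, stepFun_single]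
    by_cases hx : x ∈ E.1 <;> simp [hx]

end

section

variable {V : Type*} [NormedAddCommGroup V] [NormedSpace ℝ V]

theorem stronglyMeasurable_stepFun (φ : FinSet μ →₀ V) :
    StronglyMeasurable fun x => stepFun x φ := by
  simp only [stepFun_apply]
  exact Finset.stronglyMeasurable_fun_sum _ fun E _ => stronglyMeasurable_const.indicator E.2.1

theorem integrable_stepFun (φ : FinSet μ →₀ V) : Integrable (fun x => stepFun x φ) μ := by
  simp only [stepFun_apply]
  refine integrable_finsetSum _ fun E _ => ?_
  rw [integrable_indicator_iff E.2.1]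
  exact integrableOn_const E.2.2.ne

end

/-- The functional `∑ E, 1_E φ_E ↦ ∑ E, ∫_E u φ_E`. -/
def stepIntegral (u : OpSpace μ ν) : (FinSet μ →₀ InterSpace ν) →ₗ[ℝ] ℝ :=
  Finsupp.lsum ℝ fun E =>
    { toFun := fun a => ∫ x in E.1, (u a).1 x ∂μ
      map_add' := fun a b => by
        rw [← integral_add (integrableOn_sumSpace _ E.2.2) (integrableOn_sumSpace _ E.2.2)]
        refine setIntegral_congr_ae E.2.1 ?_
        rw [map_add]
        filter_upwards [AEEqFun.coeFn_add (u a).1 (u b).1] with x hx _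
        exact hx
      map_smul' := fun c a => by
        rw [RingHom.id_apply, smul_eq_mul, ← integral_const_mul]
        refine setIntegral_congr_ae E.2.1 ?_
        rw [map_smul]
        filter_upwards [AEEqFun.coeFn_smul c (u a).1] with x hx _
        exact hx }

theorem stepIntegral_single (u : OpSpace μ ν) (E : FinSet μ) (a : InterSpace ν) :
    stepIntegral u (Finsupp.single E a) = ∫ x in E.1, (u a).1 x ∂μ := by
  rw [stepIntegral, Finsupp.lsum_single]
  rfl

theorem stepIntegral_eq_integral (u : OpSpace μ ν) (ψ : FinSet μ →₀ InterSpace ν) :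
    stepIntegral u ψ = ∫ x, ∑ E ∈ ψ.support, E.1.indicator (fun x => (u (ψ E)).1 x) x ∂μ := by
  rw [integral_finsetSum _ fun E _ => by
    rw [integrable_indicator_iff E.2.1]
    exact integrableOn_sumSpace _ E.2.2]
  rw [stepIntegral, Finsupp.lsum_apply, Finsupp.sum]
  refine Finset.sum_congr rfl fun E _ => ?_
  rw [integral_indicator E.2.1]
  rfl

theorem aeEqFun_coeFn_sum {ι : Type*} (s : Finset ι) (g : ι → M →ₘ[μ] ℝ) :
    (∑ i ∈ s, g i : M →ₘ[μ] ℝ) =ᵐ[μ] fun x => ∑ i ∈ s, g i x := by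
  classical
  induction s using Finset.induction_on with
  | empty => exact AEEqFun.coeFn_zero
  | insert i s hi ih =>
    rw [Finset.sum_insert hi]
    filter_upwards [AEEqFun.coeFn_add (g i) (∑ i ∈ s, g i), ih] with x h1 h2
    rw [h1, Pi.add_apply, h2, Finset.sum_insert hi]

end StepFunctions

/-! ### Truncations and level sets of functions in `L^1 ∩ L^∞`. -/

noncomputable section Levels

variable {N : Type*} [MeasurableSpace N] {ν : Measure N}

theorem zero_le_const {c : ℝ} (hc : 0 ≤ c) : (0 : N →ₘ[ν] ℝ) ≤ AEEqFun.const N c := by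
  rw [← AEEqFun.coeFn_le]
  filter_upwards [AEEqFun.coeFn_const N (μ := ν) c, AEEqFun.coeFn_zero (μ := ν) (β := ℝ)]
    with x h1 h2
  rw [h1, h2]
  exact hc

/-- The truncation `f ∧ δ`. -/
def trunc (f : InterSpace ν) (hf : (0 : N →ₘ[ν] ℝ) ≤ f) (δ : ℝ) (hδ : 0 ≤ δ) : InterSpace ν :=
  ⟨f ⊓ AEEqFun.const N δ, isSolid_interSpace f.2 (by
    rw [abs_of_nonneg hf, abs_of_nonneg (le_inf hf (zero_le_const hδ))]
    exact inf_le_left)⟩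

theorem trunc_nonneg (f : InterSpace ν) (hf : (0 : N →ₘ[ν] ℝ) ≤ f) (δ : ℝ) (hδ : 0 ≤ δ) :
    (0 : N →ₘ[ν] ℝ) ≤ trunc f hf δ hδ := le_inf hf (zero_le_const hδ)

theorem coeFn_trunc (f : InterSpace ν) (hf : (0 : N →ₘ[ν] ℝ) ≤ f) (δ : ℝ) (hδ : 0 ≤ δ) :
    (trunc f hf δ hδ).1 =ᵐ[ν] fun y => min (f.1 y) δ := by
  filter_upwards [AEEqFun.coeFn_inf f.1 (AEEqFun.const N δ), AEEqFun.coeFn_const N (μ := ν) δ]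
    with y h1 h2
  exact h1.trans (by rw [h2]; rfl)

theorem ae_nonneg_of_nonneg {f : N →ₘ[ν] ℝ} (hf : 0 ≤ f) : ∀ᵐ y ∂ν, 0 ≤ f y := by
  filter_upwards [AEEqFun.coeFn_le.2 hf, AEEqFun.coeFn_zero (μ := ν) (β := ℝ)] with y h1 h2
  rw [h2] at h1
  exact h1

theorem norm_toLinf_trunc_le (f : InterSpace ν) (hf : (0 : N →ₘ[ν] ℝ) ≤ f) (δ : ℝ) (hδ : 0 ≤ δ) :
    ‖toLinf ν (trunc f hf δ hδ)‖ ≤ δ := by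
  refine linf_norm_le hδ ?_
  filter_upwards [coeFn_trunc f hf δ hδ, ae_nonneg_of_nonneg hf] with y h1 h2
  have : (toLinf ν (trunc f hf δ hδ) : N → ℝ) y = min (f.1 y) δ := h1
  rw [this, Real.norm_of_nonneg (le_min h2 hδ)]
  exact min_le_right _ _

/-- Dominated convergence, with `f` as the majorant; this removes the `‖b₁‖` part of the truncation
error. -/
theorem tendsto_norm_toL1_trunc (f : InterSpace ν) (hf : (0 : N →ₘ[ν] ℝ) ≤ f) :
    Filter.Tendsto (fun n : ℕ => ‖toL1 ν (trunc f hf (1 / ((n : ℝ) + 1)) (by positivity))‖)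
      Filter.atTop (nhds 0) := by
  have h1 : ∀ n : ℕ, ‖toL1 ν (trunc f hf (1 / ((n : ℝ) + 1)) (by positivity))‖ =
      ∫ y, min (f.1 y) (1 / ((n : ℝ) + 1)) ∂ν := by
    intro n
    rw [L1.norm_eq_integral_norm]
    refine integral_congr_ae ?_
    filter_upwards [coeFn_trunc f hf (1 / ((n : ℝ) + 1)) (by positivity), ae_nonneg_of_nonneg hf]
      with y e1 e2
    have : (toL1 ν (trunc f hf (1 / ((n : ℝ) + 1)) (by positivity)) : N → ℝ) y =
      min (f.1 y) (1 / ((n : ℝ) + 1)) := e1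
    rw [this, Real.norm_of_nonneg (le_min e2 (by positivity))]
  simp only [h1]
  have hint : Integrable (f.1 : N → ℝ) ν := L1.integrable_coeFn (toL1 ν f)
  have h2 := tendsto_integral_of_dominated_convergence (μ := ν) (f := fun _ => (0 : ℝ))
    (F := fun (n : ℕ) y => min (f.1 y) (1 / ((n : ℝ) + 1))) (fun y => f.1 y)
    (fun n => hint.aestronglyMeasurable.inf aestronglyMeasurable_const) hint
    (fun n => by
      filter_upwards [ae_nonneg_of_nonneg hf] with y hy
      rw [Real.norm_of_nonneg (le_min hy (by positivity))]
      exact min_le_left _ _)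
    (by
      filter_upwards [ae_nonneg_of_nonneg hf] with y hy
      have h3 := (tendsto_const_nhds (x := f.1 y)).min
        (tendsto_one_div_add_atTop_nhds_zero_nat (𝕜 := ℝ))
      rwa [min_eq_right hy] at h3)
  simpa using h2

/-- A layer cake estimate. -/
theorem mul_sum_measure_levels_le {g : N → ℝ} (hgm : Measurable g) (hg : Integrable g ν)
    (hg0 : ∀ᵐ y ∂ν, 0 ≤ g y) {δ : ℝ} (hδ : 0 < δ) (K : ℕ) :
    δ * ∑ i ∈ Finset.range K, ν.real {y | ((i : ℝ) + 1) * δ < g y} ≤ ∫ y, g y ∂ν := by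
  have hm : ∀ i : ℕ, MeasurableSet {y | ((i : ℝ) + 1) * δ < g y} := fun i =>
    measurableSet_lt measurable_const hgm
  have hfin : ∀ i : ℕ, ν {y | ((i : ℝ) + 1) * δ < g y} < ∞ := fun i =>
    hg.measure_gt_lt_top (by positivity)
  have hint : ∀ i : ℕ, Integrable ({y | ((i : ℝ) + 1) * δ < g y}.indicator fun _ => (1 : ℝ)) ν :=
    fun i => by
      rw [integrable_indicator_iff (hm i)]
      exact integrableOn_const (hfin i).ne
  have h1 : ∑ i ∈ Finset.range K, ν.real {y | ((i : ℝ) + 1) * δ < g y} =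
      ∫ y, ∑ i ∈ Finset.range K, {y | ((i : ℝ) + 1) * δ < g y}.indicator (fun _ => (1 : ℝ)) y
        ∂ν := by
    rw [integral_finsetSum _ fun i _ => hint i]
    refine Finset.sum_congr rfl fun i _ => ?_
    rw [integral_indicator_const _ (hm i), smul_eq_mul, mul_one]
  rw [h1, ← integral_const_mul]
  refine integral_mono_ae ((integrable_finsetSum _ fun i _ => hint i).const_mul δ) hg ?_
  filter_upwards [hg0] with y hy
  exact mul_sum_levels_le hδ hy K

theorem measurableSet_level (f : InterSpace ν) (r : ℝ) : MeasurableSet {y | r < f.1 y} :=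
  measurableSet_lt measurable_const f.1.measurable

theorem measure_level_lt_top (f : InterSpace ν) {r : ℝ} (hr : 0 < r) : ν {y | r < f.1 y} < ∞ :=
  (L1.integrable_coeFn (toL1 ν f)).measure_gt_lt_top hr

/-- The characteristic function of `{f > (i + 1) δ}`. -/
def levelFn (f : InterSpace ν) {δ : ℝ} (hδ : 0 < δ) (i : ℕ) : InterSpace ν :=
  charFn (measurableSet_level f (((i : ℝ) + 1) * δ))
    (measure_level_lt_top f (by positivity : (0 : ℝ) < ((i : ℝ) + 1) * δ))

theorem coeFn_charFn {F : Set N} (hF : MeasurableSet F) (hν : ν F < ∞) :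
    (charFn hF hν).1 =ᵐ[ν] F.indicator fun _ => (1 : ℝ) := AEEqFun.coeFn_mk _ _

theorem charFn_nonneg {F : Set N} (hF : MeasurableSet F) (hν : ν F < ∞) :
    (0 : N →ₘ[ν] ℝ) ≤ charFn hF hν := by
  rw [← AEEqFun.coeFn_le]
  filter_upwards [coeFn_charFn hF hν, AEEqFun.coeFn_zero (μ := ν) (β := ℝ)] with y h1 h2
  rw [h1, h2]
  exact Set.indicator_nonneg (fun _ _ => zero_le_one) y

/-- A function bounded by `f` and by `n δ` is bounded by a sum over the level sets of `f`. -/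
theorem abs_le_trunc_add_levels {f a : InterSpace ν} (hf : (0 : N →ₘ[ν] ℝ) ≤ f) {δ : ℝ}
    (hδ : 0 < δ) {K n : ℕ} (hK : ‖toLinf ν f‖ ≤ K * δ) (ha : |(a : N →ₘ[ν] ℝ)| ≤ f)
    (han : ‖toLinf ν a‖ ≤ n * δ) :
    |(a : N →ₘ[ν] ℝ)| ≤ (trunc f hf δ hδ.le +
      δ • ∑ i ∈ Finset.range K, (if i + 1 < n then levelFn f hδ i else 0) : InterSpace ν) := by
  set S : InterSpace ν := ∑ i ∈ Finset.range K, (if i + 1 < n then levelFn f hδ i else 0) with hS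
  have hS' : S.1 =ᵐ[ν] fun y => ∑ i ∈ Finset.range K,
      (if i + 1 < n then levelFn f hδ i else 0 : InterSpace ν).1 y := by
    rw [hS, Submodule.coe_sum]
    exact aeEqFun_coeFn_sum _ _
  have hlev : ∀ᵐ y ∂ν, ∀ i : ℕ, (levelFn f hδ i).1 y =
      {y | ((i : ℝ) + 1) * δ < f.1 y}.indicator (fun _ => (1 : ℝ)) y :=
    ae_all_iff.2 fun i => coeFn_charFn _ _
  rw [← AEEqFun.coeFn_le]
  filter_upwards [AEEqFun.coeFn_add (trunc f hf δ hδ.le).1 (δ • S).1,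
    AEEqFun.coeFn_smul δ S.1, hS', coeFn_trunc f hf δ hδ.le, AEEqFun.coeFn_abs a.1,
    AEEqFun.coeFn_le.2 ha, ae_abs_le_norm (toLinf ν a), ae_abs_le_norm (toLinf ν f), hlev,
    AEEqFun.coeFn_zero (μ := ν) (β := ℝ)] with y e1 e2 e3 e4 e5 e6 e7 e8 e9 e10
  rw [e5] at e6 ⊢
  refine (le_min_add_mul_sum_levels hδ (n := n) ((le_abs_self _).trans (e8.trans hK)) e6
    (e7.trans han)).trans (le_of_eq ?_)
  refine Eq.trans ?_ e1.symm
  have e2' : (δ • S).1 y = δ * S.1 y := e2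
  rw [Pi.add_apply, e4, e2', e3]
  congr 2
  refine Finset.sum_congr rfl fun i _ => ?_
  split_ifs with _ h2
  · rw [e9 i, Set.indicator_of_mem (show y ∈ {y | ((i : ℝ) + 1) * δ < f.1 y} from h2)]
  · rw [e9 i, Set.indicator_of_notMem (show y ∉ {y | ((i : ℝ) + 1) * δ < f.1 y} from h2)]
  · exact e10.symm

end Levels

/-! ### From rectangles to all step functions. -/

section MainInequality

variable {M N : Type*} [MeasurableSpace M] [MeasurableSpace N] {μ : Measure M} {ν : Measure N}

/-- The values of `u` on a step function, pointwise. -/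
theorem ae_sum_indicator_eq (u : OpSpace μ ν) (ψ : FinSet μ →₀ InterSpace ν) :
    ∀ᵐ x ∂μ, ∑ E ∈ ψ.support, E.1.indicator (fun x => (u (ψ E)).1 x) x =
      (u (stepFun x ψ)).1 x := by
  classical
  have h : ∀ᵐ x ∂μ, ∀ s ∈ ψ.support.powerset, (u (∑ E ∈ s, ψ E)).1 x =
      ∑ E ∈ s, (u (ψ E)).1 x := by
    rw [Filter.eventually_all_finset]
    intro s _
    rw [map_sum, Submodule.coe_sum]
    exact aeEqFun_coeFn_sum _ _
  filter_upwards [h] with x hx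
  rw [stepFun_eq_sum_filter, hx _ (Finset.mem_powerset.2 (Finset.filter_subset _ _)),
    Finset.sum_filter]
  rfl

/-- `u a` is at most the modulus of `u` applied to the layer bound for `|a|`, and the modulus is
linear. -/
theorem IsSupModulus.ae_apply_le {u v : OpSpace μ ν} (huv : IsSupModulus u v)
    {f : InterSpace ν} (hf : (0 : N →ₘ[ν] ℝ) ≤ f) {δ : ℝ} (hδ : 0 < δ) {K : ℕ}
    (hK : ‖toLinf ν f‖ ≤ K * δ) (a : InterSpace ν) (ha : |(a : N →ₘ[ν] ℝ)| ≤ f) (n : ℕ)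
    (han : ‖toLinf ν a‖ ≤ n * δ) :
    ∀ᵐ x ∂μ, (u a).1 x ≤ (v (trunc f hf δ hδ.le)).1 x +
      δ * ∑ i ∈ Finset.range K, (if i + 1 < n then (v (levelFn f hδ i)).1 x else 0) := by
  have h1 := huv.apply_le (abs_le_trunc_add_levels hf hδ hK ha han)
  rw [map_add, map_smul, map_sum] at h1
  filter_upwards [AEEqFun.coeFn_le.2 h1,
    AEEqFun.coeFn_add (v (trunc f hf δ hδ.le)).1
      (δ • ∑ i ∈ Finset.range K, v (if i + 1 < n then levelFn f hδ i else 0)).1,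
    AEEqFun.coeFn_smul δ (∑ i ∈ Finset.range K, v (if i + 1 < n then levelFn f hδ i else 0)).1,
    aeEqFun_coeFn_sum (Finset.range K)
      (fun i => (v (if i + 1 < n then levelFn f hδ i else 0)).1),
    AEEqFun.coeFn_zero (μ := μ) (β := ℝ)] with x e1 e2 e3 e4 e5
  refine e1.trans (le_of_eq (e2.trans ?_))
  rw [Pi.add_apply]
  congr 1
  refine Eq.trans e3 ?_
  rw [Pi.smul_apply, smul_eq_mul, Submodule.coe_sum, e4]
  congr 1
  refine Finset.sum_congr rfl fun i _ => ?_
  split_ifs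
  · rfl
  · rw [map_zero]
    exact e5

/-- At the point `x` only the layers below `g x = ‖ψ(x)‖_∞` are needed, so level sets of `g` and of
`f` at the same height form rectangles. The bounds `hrect` on these add up to the two layer cake
sums, for `∫ g` and for `‖f‖_1`. -/
theorem IsSupModulus.stepIntegral_le_add {u v : OpSpace μ ν} (huv : IsSupModulus u v)
    {C C' : ℝ}
    (hrect : ∀ (E : Set M) (F : Set N) (_ : MeasurableSet E) (hF : MeasurableSet F)
      (_ : μ E < ∞) (hν : ν F < ∞),
      ∫ x in E, (v (charFn hF hν)).1 x ∂μ ≤ C * μ.real E + C' * ν.real F)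
    (hC : 0 ≤ C) (hC' : 0 ≤ C')
    (ψ : FinSet μ →₀ InterSpace ν) {f : InterSpace ν} (hf : (0 : N →ₘ[ν] ℝ) ≤ f)
    (hψ : ∀ x, |((stepFun x ψ : InterSpace ν) : N →ₘ[ν] ℝ)| ≤ f) {δ : ℝ} (hδ : 0 < δ) :
    stepIntegral u ψ ≤
      ∫ x in ⋃ E ∈ ψ.support, E.1, (v (trunc f hf δ hδ.le)).1 x ∂μ +
      (C * ∫ x, ‖stepFun x (Finsupp.mapRange.linearMap (toLinf ν) ψ)‖ ∂μ + C' * ‖toL1 ν f‖) := by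
  classical
  set g : M → ℝ := fun x => ‖stepFun x (Finsupp.mapRange.linearMap (toLinf ν) ψ)‖ with hg
  have hgm : Measurable g := (stronglyMeasurable_stepFun _).norm.measurable
  have hgi : Integrable g μ := (integrable_stepFun _).norm
  set A : Set M := ⋃ E ∈ ψ.support, E.1 with hA
  have hAm : MeasurableSet A := Finset.measurableSet_biUnion _ fun E _ => E.2.1
  have hAfin : μ A < ∞ := measure_biUnion_lt_top ψ.support.finite_toSet fun E _ => E.2.2
  obtain ⟨K, hK⟩ : ∃ K : ℕ, ‖toLinf ν f‖ ≤ K * δ := by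
    obtain ⟨K, hK⟩ := exists_nat_ge (‖toLinf ν f‖ / δ)
    exact ⟨K, (div_le_iff₀ hδ).1 hK⟩
  let G : ℕ → Set M := fun i => {x | ((i : ℝ) + 1) * δ < g x}
  have hGm : ∀ i, MeasurableSet (G i) := fun i => measurableSet_lt measurable_const hgm
  have hGfin : ∀ i, μ (G i) < ∞ := fun i => hgi.measure_gt_lt_top (by positivity)
  -- The argument of `u` will depend on `x`; quantifying over all subset sums and all `n` first
  -- keeps the exceptional set null.
  have hmain : ∀ᵐ x ∂μ, ∀ s ∈ ψ.support.powerset, ∀ n : ℕ,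
      |((∑ E ∈ s, ψ E : InterSpace ν) : N →ₘ[ν] ℝ)| ≤ f →
      ‖toLinf ν (∑ E ∈ s, ψ E)‖ ≤ n * δ →
      (u (∑ E ∈ s, ψ E)).1 x ≤ (v (trunc f hf δ hδ.le)).1 x +
        δ * ∑ i ∈ Finset.range K, (if i + 1 < n then (v (levelFn f hδ i)).1 x else 0) := by
    rw [Filter.eventually_all_finset]
    intro s _
    rw [ae_all_iff]
    intro n
    by_cases h1 : |((∑ E ∈ s, ψ E : InterSpace ν) : N →ₘ[ν] ℝ)| ≤ f
    · by_cases h2 : ‖toLinf ν (∑ E ∈ s, ψ E)‖ ≤ n * δ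
      · filter_upwards [huv.ae_apply_le hf hδ hK _ h1 n h2] with x hx _ _ using hx
      · exact Filter.Eventually.of_forall fun x _ h => absurd h h2
    · exact Filter.Eventually.of_forall fun x h => absurd h h1
  have hlev0 : ∀ᵐ x ∂μ, ∀ i : ℕ, 0 ≤ (v (levelFn f hδ i)).1 x :=
    ae_all_iff.2 fun i => ae_nonneg_of_nonneg (huv.nonneg (charFn_nonneg _ _))
  have hpt : ∀ᵐ x ∂μ, ∑ E ∈ ψ.support, E.1.indicator (fun x => (u (ψ E)).1 x) x ≤
      A.indicator (fun x => (v (trunc f hf δ hδ.le)).1 x) x +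
      δ * ∑ i ∈ Finset.range K, (G i).indicator (fun x => (v (levelFn f hδ i)).1 x) x := by
    filter_upwards [hmain, hlev0, ae_sum_indicator_eq u ψ] with x h1 h2 h3
    by_cases hx : x ∈ A
    · rw [h3, Set.indicator_of_mem hx]
      have hs := stepFun_eq_sum_filter x ψ
      have hgx : g x = ‖toLinf ν (stepFun x ψ)‖ := by rw [hg]; simp only [stepFun_mapRange]
      have h4 := h1 _ (Finset.mem_powerset.2 (Finset.filter_subset (fun E => x ∈ E.1) ψ.support))
        ⌈g x / δ⌉₊ (by rw [← hs]; exact hψ x)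
        (by rw [← hs, ← hgx, ← div_le_iff₀ hδ]; exact Nat.le_ceil _)
      rw [← hs] at h4
      refine h4.trans (le_of_eq ?_)
      congr 2
      refine Finset.sum_congr rfl fun i _ => ?_
      -- Taking `n = ⌈g x / δ⌉₊` turns the cutoff on indices into membership in the level set `G i`.
      have hiff : i + 1 < ⌈g x / δ⌉₊ ↔ x ∈ G i := by
        rw [Nat.lt_ceil, lt_div_iff₀ hδ]
        push_cast
        rfl
      by_cases hi : x ∈ G i
      · rw [if_pos (hiff.2 hi), Set.indicator_of_mem hi]
      · rw [if_neg (fun h => hi (hiff.1 h)), Set.indicator_of_notMem hi]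
    · rw [Set.indicator_of_notMem hx, zero_add]
      have h4 : ∑ E ∈ ψ.support, E.1.indicator (fun x => (u (ψ E)).1 x) x = 0 :=
        Finset.sum_eq_zero fun E hE => Set.indicator_of_notMem
          (fun hxE => hx (Set.mem_biUnion (s := (ψ.support : Set (FinSet μ))) hE hxE)) _
      rw [h4]
      exact mul_nonneg hδ.le (Finset.sum_nonneg fun i _ => Set.indicator_apply_nonneg fun _ => h2 i)
  have hint₁ : Integrable (A.indicator fun x => (v (trunc f hf δ hδ.le)).1 x) μ := by
    rw [integrable_indicator_iff hAm]
    exact integrableOn_sumSpace _ hAfin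
  have hint₂ : ∀ i, Integrable ((G i).indicator fun x => (v (levelFn f hδ i)).1 x) μ := by
    intro i
    rw [integrable_indicator_iff (hGm i)]
    exact integrableOn_sumSpace _ (hGfin i)
  have hint₃ : Integrable (fun x => δ * ∑ i ∈ Finset.range K,
      (G i).indicator (fun x => (v (levelFn f hδ i)).1 x) x) μ :=
    (integrable_finsetSum _ fun i _ => hint₂ i).const_mul δ
  have hint₀ : Integrable (fun x => ∑ E ∈ ψ.support,
      E.1.indicator (fun x => (u (ψ E)).1 x) x) μ :=
    integrable_finsetSum _ fun E _ => by
      rw [integrable_indicator_iff E.2.1]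
      exact integrableOn_sumSpace _ E.2.2
  rw [stepIntegral_eq_integral]
  refine (integral_mono_ae hint₀ (hint₁.add hint₃) hpt).trans ?_
  rw [integral_add' hint₁ hint₃, integral_indicator hAm, integral_const_mul,
    integral_finsetSum _ fun i _ => hint₂ i]
  refine add_le_add le_rfl ?_
  have h5 : ∀ i ∈ Finset.range K, ∫ x, (G i).indicator (fun x => (v (levelFn f hδ i)).1 x) x ∂μ ≤
      C * μ.real (G i) + C' * ν.real {y | ((i : ℝ) + 1) * δ < f.1 y} := by
    intro i _
    rw [integral_indicator (hGm i)]
    exact hrect _ _ (hGm i) _ (hGfin i) _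
  have h6 := mul_sum_measure_levels_le hgm hgi (Filter.Eventually.of_forall fun x => norm_nonneg _)
    hδ K
  have h7 := mul_sum_measure_levels_le f.1.measurable (L1.integrable_coeFn (toL1 ν f))
    (ae_nonneg_of_nonneg hf) hδ K
  have h8 : ∫ y, f.1 y ∂ν = ‖toL1 ν f‖ := by
    rw [L1.norm_eq_integral_norm]
    refine integral_congr_ae ?_
    filter_upwards [ae_nonneg_of_nonneg hf] with y hy
    exact (Real.norm_of_nonneg hy).symm
  rw [h8] at h7
  calc δ * ∑ i ∈ Finset.range K, ∫ x, (G i).indicator (fun x => (v (levelFn f hδ i)).1 x) x ∂μ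
      ≤ δ * ∑ i ∈ Finset.range K,
        (C * μ.real (G i) + C' * ν.real {y | ((i : ℝ) + 1) * δ < f.1 y}) :=
        mul_le_mul_of_nonneg_left (Finset.sum_le_sum h5) hδ.le
    _ = C * (δ * ∑ i ∈ Finset.range K, μ.real (G i)) +
        C' * (δ * ∑ i ∈ Finset.range K, ν.real {y | ((i : ℝ) + 1) * δ < f.1 y}) := by
        rw [Finset.sum_add_distrib, ← Finset.mul_sum, ← Finset.mul_sum]
        ring
    _ ≤ _ := add_le_add (mul_le_mul_of_nonneg_left h6 hC) (mul_le_mul_of_nonneg_left h7 hC')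

/-- The bounds on rectangles imply the bound on all step functions. -/
theorem IsSupModulus.stepIntegral_le {u v : OpSpace μ ν} (huv : IsSupModulus u v)
    (hu : u ∈ sumB μ ν) {C C' : ℝ}
    (hrect : ∀ (E : Set M) (F : Set N) (_ : MeasurableSet E) (hF : MeasurableSet F)
      (_ : μ E < ∞) (hν : ν F < ∞),
      ∫ x in E, (v (charFn hF hν)).1 x ∂μ ≤ C * μ.real E + C' * ν.real F)
    (hC : 0 ≤ C) (hC' : 0 ≤ C')
    (ψ : FinSet μ →₀ InterSpace ν) {f : InterSpace ν} (hf : (0 : N →ₘ[ν] ℝ) ≤ f)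
    (hψ : ∀ x, |((stepFun x ψ : InterSpace ν) : N →ₘ[ν] ℝ)| ≤ f) :
    stepIntegral u ψ ≤
      C * ∫ x, ‖stepFun x (Finsupp.mapRange.linearMap (toLinf ν) ψ)‖ ∂μ + C' * ‖toL1 ν f‖ := by
  obtain ⟨_, ⟨b₀, rfl⟩, _, ⟨b₁, rfl⟩, rfl⟩ := Submodule.mem_sup.1 hu
  have hAfin : μ (⋃ E ∈ ψ.support, E.1) < ∞ :=
    measure_biUnion_lt_top ψ.support.finite_toSet fun E _ => E.2.2
  set R := C * ∫ x, ‖stepFun x (Finsupp.mapRange.linearMap (toLinf ν) ψ)‖ ∂μ + C' * ‖toL1 ν f‖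
    with hR
  -- The norms of `b₀` and `b₁` enter only through the truncation error, which vanishes as `δ = 1 /
  -- (n + 1)` tends to zero.
  have h1 : ∀ n : ℕ, stepIntegral (ofB0 μ ν b₀ + ofB1 μ ν b₁) ψ ≤
      ‖b₀‖ * (1 / ((n : ℝ) + 1)) * μ.real (⋃ E ∈ ψ.support, E.1) +
      ‖b₁‖ * ‖toL1 ν (trunc f hf (1 / ((n : ℝ) + 1)) (by positivity))‖ + R := by
    intro n
    have hδ : 0 < 1 / ((n : ℝ) + 1) := by positivity
    refine (huv.stepIntegral_le_add hrect hC hC' ψ hf hψ hδ).trans (add_le_add ?_ le_rfl)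
    refine (huv.setIntegral_le (trunc_nonneg f hf _ hδ.le) hAfin).trans (add_le_add ?_ le_rfl)
    exact mul_le_mul_of_nonneg_right (mul_le_mul_of_nonneg_left
      (norm_toLinf_trunc_le f hf _ hδ.le) (norm_nonneg _)) measureReal_nonneg
  have h2 := ((((tendsto_one_div_add_atTop_nhds_zero_nat (𝕜 := ℝ)).const_mul ‖b₀‖).mul_const
    (μ.real (⋃ E ∈ ψ.support, E.1))).add
    ((tendsto_norm_toL1_trunc f hf).const_mul ‖b₁‖)).add_const R
  have h3 := ge_of_tendsto' h2 h1
  simpa using h3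

end MainInequality

/-! ### Semifinite measures and membership in `L^1`. -/

section Semifinite

variable {M : Type*} [MeasurableSpace M] {μ : Measure M}

/-- Otherwise the finite measures of subsets of `A` have a finite supremum, attained by a countable
union. Its complement in `A` still has infinite measure, and a piece of it with positive finite
measure would exceed the supremum. -/
theorem IsSemifinite.exists_subset_lt (hμ : IsSemifinite μ) {A : Set M} (hA : MeasurableSet A)
    (hA' : μ A = ∞) {r : ℝ≥0∞} (hr : r ≠ ∞) :
    ∃ B ⊆ A, MeasurableSet B ∧ μ B < ∞ ∧ r < μ B := by
  by_contra! hcon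
  let S : Set ℝ≥0∞ := {m | ∃ B ⊆ A, MeasurableSet B ∧ μ B < ∞ ∧ μ B = m}
  have hSr : sSup S ≤ r := sSup_le (by rintro _ ⟨B, h1, h2, h3, rfl⟩; exact hcon B h1 h2 h3)
  obtain ⟨m, -, hm, hmS⟩ := exists_seq_tendsto_sSup (S := S)
    ⟨_, ∅, Set.empty_subset _, MeasurableSet.empty, by simp, rfl⟩ (OrderTop.bddAbove S)
  choose B hBA hBm hBfin hBeq using hmS
  have hacc : ∀ n, μ (Set.accumulate B n) ≤ sSup S := by
    intro n
    refine le_sSup ⟨_, ?_, ?_, ?_, rfl⟩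
    · exact Set.iUnion₂_subset fun i _ => hBA i
    · exact MeasurableSet.biUnion (Set.to_countable _) fun i _ => hBm i
    · exact measure_biUnion_lt_top (Set.finite_Iic n) fun i _ => hBfin i
  have hD : μ (⋃ n, B n) ≤ sSup S := by
    rw [measure_iUnion_eq_iSup_accumulate]
    exact iSup_le hacc
  have hDS : sSup S ≤ μ (⋃ n, B n) := le_of_tendsto' hm fun n => by
    rw [← hBeq n]
    exact measure_mono (Set.subset_iUnion B n)
  have hDm : MeasurableSet (⋃ n, B n) := MeasurableSet.iUnion hBm
  have hDfin : μ (⋃ n, B n) < ∞ := (hD.trans hSr).trans_lt (lt_top_iff_ne_top.2 hr)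
  have hDA : ⋃ n, B n ⊆ A := Set.iUnion_subset hBA
  obtain ⟨C, hCA, hCm, hC0, hCfin⟩ := hμ (A \ ⋃ n, B n) (hA.diff hDm)
    (by rw [measure_sdiff hDA hDm.nullMeasurableSet hDfin.ne, hA', ENNReal.top_sub hDfin.ne])
  have hdisj : Disjoint (⋃ n, B n) C :=
    Set.disjoint_left.2 fun x hx hxC => (hCA hxC).2 hx
  have hun : μ ((⋃ n, B n) ∪ C) = μ (⋃ n, B n) + μ C := measure_union hdisj hCm
  have h1 : μ ((⋃ n, B n) ∪ C) ≤ sSup S :=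
    le_sSup ⟨_, Set.union_subset hDA (hCA.trans Set.sdiff_subset), hDm.union hCm,
      by rw [hun]; exact ENNReal.add_lt_top.2 ⟨hDfin, hCfin⟩, rfl⟩
  rw [hun] at h1
  exact absurd (h1.trans hDS) (not_le.2 (ENNReal.lt_add_right hDfin.ne hC0.ne'))

/-- Over a semifinite measure, the integral of a nonnegative function is controlled by its
integrals over sets of finite measure. -/
theorem IsSemifinite.lintegral_le (hμ : IsSemifinite μ) {g : M → ℝ≥0∞} (hg : Measurable g)
    {K : ℝ≥0∞} (hK : K ≠ ∞)
    (h : ∀ E : Set M, MeasurableSet E → μ E < ∞ → ∫⁻ x in E, g x ∂μ ≤ K) :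
    ∫⁻ x, g x ∂μ ≤ K := by
  let A : ℕ → Set M := fun n => {x | ((n : ℝ≥0∞) + 1)⁻¹ ≤ g x}
  have hAm : ∀ n, MeasurableSet (A n) := fun n => measurableSet_le measurable_const hg
  have hAmono : Monotone A := fun n m hnm x hx =>
    le_trans (ENNReal.inv_le_inv.2 (add_le_add (Nat.cast_le.2 hnm) le_rfl)) hx
  -- If `A n` had infinite measure, a subset of finite measure larger than `(n + 1) K` would violate
  -- the bound `h`.
  have hAfin : ∀ n, μ (A n) < ∞ := by
    intro n
    by_contra hcon
    have htop : μ (A n) = ∞ := not_lt_top_iff.1 hcon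
    have hn : ((n : ℝ≥0∞) + 1) ≠ ∞ := by simp
    have hn0 : ((n : ℝ≥0∞) + 1) ≠ 0 := by simp
    obtain ⟨B, hBA, hBm, hBfin, hB⟩ := hμ.exists_subset_lt (hAm n) htop
      (ENNReal.mul_ne_top hn hK)
    have h1 : ((n : ℝ≥0∞) + 1)⁻¹ * μ B ≤ K := by
      refine le_trans ?_ (h B hBm hBfin)
      rw [← setLIntegral_const]
      exact setLIntegral_mono hg fun x hx => hBA hx
    have h2 : μ B ≤ ((n : ℝ≥0∞) + 1) * K := by
      have := mul_le_mul_right h1 ((n : ℝ≥0∞) + 1)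
      rwa [← mul_assoc, ENNReal.mul_inv_cancel hn0 hn, one_mul] at this
    exact absurd h2 (not_le.2 hB)
  have hsupp : ∀ x, ⨆ n, (A n).indicator g x = g x := by
    intro x
    refine le_antisymm (iSup_le fun n => Set.indicator_le_self _ _ _) ?_
    rcases eq_or_ne (g x) 0 with h0 | h0
    · rw [h0]; exact zero_le
    · obtain ⟨n, hn⟩ := ENNReal.exists_inv_nat_lt h0
      have hx : x ∈ A n := (ENNReal.inv_le_inv.2 le_self_add).trans hn.le
      exact le_iSup_of_le n (by rw [Set.indicator_of_mem hx])
  have h1 : ∫⁻ x, g x ∂μ = ⨆ n, ∫⁻ x, (A n).indicator g x ∂μ := by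
    rw [← lintegral_iSup (fun n => hg.indicator (hAm n)) fun n m hnm x =>
      Set.indicator_le_indicator_of_subset (hAmono hnm) (fun _ => zero_le) x]
    exact lintegral_congr fun x => (hsupp x).symm
  rw [h1]
  refine iSup_le fun n => ?_
  rw [lintegral_indicator (hAm n)]
  exact h _ (hAm n) (hAfin n)

theorem IsSemifinite.memLp_one (hμ : IsSemifinite μ) (w : SumSpace μ) {K : ℝ} (hK : 0 ≤ K)
    (h : ∀ E : Set M, MeasurableSet E → μ E < ∞ → ∫ x in E, ‖w.1 x‖ ∂μ ≤ K) :
    ∃ hw : w.1 ∈ Lp ℝ 1 μ, ‖(⟨w.1, hw⟩ : Lp ℝ 1 μ)‖ ≤ K := by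
  have h1 : eLpNorm w.1 1 μ ≤ ENNReal.ofReal K := by
    rw [eLpNorm_one_eq_lintegral_enorm]
    refine hμ.lintegral_le w.1.measurable.enorm ENNReal.ofReal_ne_top fun E hE hfin => ?_
    rw [← ofReal_integral_norm_eq_lintegral_enorm (integrableOn_sumSpace w hfin)]
    exact ENNReal.ofReal_le_ofReal (h E hE hfin)
  have hw : w.1 ∈ Lp ℝ 1 μ := Lp.mem_Lp_iff_eLpNorm_lt_top.2 (h1.trans_lt ENNReal.ofReal_lt_top)
  exact ⟨hw, by rw [Lp.norm_def]; exact ENNReal.toReal_le_of_le_ofReal hK h1⟩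

theorem denseRange_toL1 (ν : Measure M) : DenseRange (toL1 ν) := by
  intro f
  have hmem : f ∈ (LinearMap.range (toL1 ν)).topologicalClosure := by
    refine Lp.induction (by simp)
      (motive := fun f => f ∈ (LinearMap.range (toL1 ν)).topologicalClosure) ?_ ?_ ?_ f
    · intro c s hs hνs
      refine Submodule.le_topologicalClosure _ ?_
      rw [Lp.simpleFunc.coe_indicatorConst]
      refine ⟨⟨(indicatorConstLp 1 hs hνs.ne c).1, (indicatorConstLp 1 hs hνs.ne c).2,
        (indicatorConstLp ∞ hs hνs.ne c).2⟩, rfl⟩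
    · intro f g hf hg _ h1 h2
      exact Submodule.add_mem _ h1 h2
    · exact Submodule.isClosed_topologicalClosure _
  exact hmem

end Semifinite

/-! ### Construction of the two operators. -/

section Splitting

variable {M N : Type*} [MeasurableSpace M] [MeasurableSpace N] {μ : Measure M} {ν : Measure N}

theorem abs_mem_interSpace (a : InterSpace ν) : |(a : N →ₘ[ν] ℝ)| ∈ InterSpace ν :=
  isSolid_interSpace a.2 (by rw [abs_of_nonneg (abs_nonneg _)])

/-- The functions dominating all values of a step function. -/
def dominators (ψ : FinSet μ →₀ InterSpace ν) : Set (InterSpace ν) :=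
  {f | (0 : N →ₘ[ν] ℝ) ≤ f ∧ ∀ x, |((stepFun x ψ : InterSpace ν) : N →ₘ[ν] ℝ)| ≤ f}

theorem dominators_nonempty (ψ : FinSet μ →₀ InterSpace ν) : (dominators ψ).Nonempty := by
  classical
  let A : FinSet μ → InterSpace ν := fun E => ⟨_, abs_mem_interSpace (ψ E)⟩
  have hA : ∀ E, (0 : N →ₘ[ν] ℝ) ≤ (A E).1 := fun E => abs_nonneg _
  refine ⟨∑ E ∈ ψ.support, A E, ?_, fun x => ?_⟩
  · rw [Submodule.coe_sum]
    exact Finset.sum_nonneg fun E _ => hA E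
  · rw [stepFun_eq_sum_filter, Submodule.coe_sum, Submodule.coe_sum]
    refine le_trans ?_ (Finset.sum_le_sum_of_subset_of_nonneg
      (Finset.filter_subset (fun E => x ∈ E.1) ψ.support) fun E _ _ => hA E)
    generalize ψ.support.filter (fun E => x ∈ E.1) = s
    induction s using Finset.induction_on with
    | empty => rw [Finset.sum_empty, Finset.sum_empty, abs_zero]
    | insert E s hE ih =>
      rw [Finset.sum_insert hE, Finset.sum_insert hE]
      exact (abs_add_le _ _).trans (add_le_add le_rfl ih)

theorem smul_mem_dominators {c : ℝ} (hc : 0 ≤ c) {ψ : FinSet μ →₀ InterSpace ν} {f : InterSpace ν}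
    (hf : f ∈ dominators ψ) : c • f ∈ dominators (c • ψ) := by
  refine ⟨smul_nonneg hc hf.1, fun x => ?_⟩
  have h2 := smul_le_smul_of_nonneg_left (lattice_abs_le.1 (hf.2 x)).1 hc
  have h3 := smul_le_smul_of_nonneg_left (lattice_abs_le.1 (hf.2 x)).2 hc
  rw [smul_neg] at h2
  rw [map_smul]
  exact lattice_abs_le.2 ⟨h2, h3⟩

theorem add_mem_dominators {ψ ψ' : FinSet μ →₀ InterSpace ν} {f f' : InterSpace ν}
    (hf : f ∈ dominators ψ) (hf' : f' ∈ dominators ψ') : f + f' ∈ dominators (ψ + ψ') := by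
  refine ⟨add_nonneg hf.1 hf'.1, fun x => ?_⟩
  rw [map_add]
  exact (abs_add_le _ _).trans (add_le_add (hf.2 x) (hf'.2 x))

/-- The norm of a step function in `L^1(ν; ℓ^∞)`. -/
noncomputable def domNorm (ψ : FinSet μ →₀ InterSpace ν) : ℝ := sInf ((fun f => ‖toL1 ν f‖) '' dominators ψ)

theorem domNorm_le {ψ : FinSet μ →₀ InterSpace ν} {f : InterSpace ν} (hf : f ∈ dominators ψ) :
    domNorm ψ ≤ ‖toL1 ν f‖ :=
  csInf_le ⟨0, by rintro _ ⟨f, -, rfl⟩; exact norm_nonneg _⟩ ⟨f, hf, rfl⟩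

theorem le_domNorm {ψ : FinSet μ →₀ InterSpace ν} {r : ℝ}
    (h : ∀ f ∈ dominators ψ, r ≤ ‖toL1 ν f‖) : r ≤ domNorm ψ :=
  le_csInf ((dominators_nonempty ψ).image _) (by rintro _ ⟨f, hf, rfl⟩; exact h f hf)

theorem domNorm_smul {c : ℝ} (hc : 0 < c) (ψ : FinSet μ →₀ InterSpace ν) :
    domNorm (c • ψ) = c * domNorm ψ := by
  have key : ∀ {c : ℝ}, 0 < c → ∀ ψ : FinSet μ →₀ InterSpace ν,
      domNorm (c • ψ) ≤ c * domNorm ψ := by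
    intro c hc ψ
    rw [← div_le_iff₀' hc]
    refine le_domNorm fun f hf => ?_
    rw [div_le_iff₀' hc]
    refine (domNorm_le (smul_mem_dominators hc.le hf)).trans (le_of_eq ?_)
    rw [map_smul, norm_smul, Real.norm_of_nonneg hc.le]
  refine le_antisymm (key hc ψ) ?_
  have h1 := key (inv_pos.2 hc) (c • ψ)
  rwa [smul_smul, inv_mul_cancel₀ hc.ne', one_smul, ← div_eq_inv_mul, le_div_iff₀' hc] at h1

theorem domNorm_add_le (ψ ψ' : FinSet μ →₀ InterSpace ν) :
    domNorm (ψ + ψ') ≤ domNorm ψ + domNorm ψ' := by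
  rw [← sub_le_iff_le_add]
  refine le_domNorm fun f hf => ?_
  rw [sub_le_comm]
  refine le_domNorm fun f' hf' => ?_
  rw [sub_le_iff_le_add']
  refine (domNorm_le (add_mem_dominators hf hf')).trans ?_
  rw [map_add]
  exact norm_add_le _ _

/-- Hahn-Banach splitting of `stepIntegral u`. -/
theorem exists_split_stepIntegral {u : OpSpace μ ν} {C C' : ℝ} (hC : 0 ≤ C) (hC' : 0 ≤ C')
    (h : ∀ ψ : FinSet μ →₀ InterSpace ν, ∀ f ∈ dominators ψ, stepIntegral u ψ ≤
      C * ∫ x, ‖stepFun x (Finsupp.mapRange.linearMap (toLinf ν) ψ)‖ ∂μ + C' * ‖toL1 ν f‖) :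
    ∃ B : (FinSet μ →₀ Lp ℝ ∞ ν) →ₗ[ℝ] ℝ, (∀ φ, B φ ≤ C * ∫ x, ‖stepFun x φ‖ ∂μ) ∧
      ∀ ψ : FinSet μ →₀ InterSpace ν, ∀ f ∈ dominators ψ,
        stepIntegral u ψ - B (Finsupp.mapRange.linearMap (toLinf ν) ψ) ≤ C' * ‖toL1 ν f‖ := by
  obtain ⟨B, hB1, hB2⟩ := exists_linearMap_of_le_add_sublinear
    (Finsupp.mapRange.linearMap (toLinf ν)) (stepIntegral u)
    (fun φ : FinSet μ →₀ Lp ℝ ∞ ν => C * ∫ x, ‖stepFun x φ‖ ∂μ) (fun ψ => C' * domNorm ψ)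
    (fun c hc φ => by
      simp only [map_smul, norm_smul, Real.norm_of_nonneg hc.le, integral_const_mul]
      ring)
    (fun φ φ' => by
      rw [← mul_add, ← integral_add (integrable_stepFun φ).norm (integrable_stepFun φ').norm]
      refine mul_le_mul_of_nonneg_left (integral_mono (integrable_stepFun _).norm
        ((integrable_stepFun φ).norm.add (integrable_stepFun φ').norm) fun x => ?_) hC
      simp only [map_add]
      exact norm_add_le _ _)
    (fun c hc ψ => by
      rw [domNorm_smul hc]
      ring)
    (fun ψ ψ' => by
      rw [← mul_add]
      exact mul_le_mul_of_nonneg_left (domNorm_add_le ψ ψ') hC')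
    (fun ψ => by
      -- Passing to the infimum over dominators divides by `C'`, so `C' = 0` is separate.
      rcases hC'.eq_or_lt with h0 | h0
      · obtain ⟨f, hf⟩ := dominators_nonempty ψ
        simpa [← h0] using h ψ f hf
      · rw [← sub_le_iff_le_add', ← div_le_iff₀' h0]
        refine le_domNorm fun f hf => ?_
        rw [div_le_iff₀' h0, sub_le_iff_le_add']
        exact h ψ f hf)
  exact ⟨B, hB1, fun ψ f hf => (hB2 ψ).trans (mul_le_mul_of_nonneg_left (domNorm_le hf) hC')⟩

/-- A linear functional bounded in `L^1(μ; L^∞(ν))` is given by an operator into `L^∞(μ)`. -/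
theorem exists_B0_of_functional (hμ : IsLocalizable μ) {C : ℝ} (hC : 0 ≤ C)
    (B : (FinSet μ →₀ Lp ℝ ∞ ν) →ₗ[ℝ] ℝ) (hB : ∀ φ, B φ ≤ C * ∫ x, ‖stepFun x φ‖ ∂μ) :
    ∃ b : B0 μ ν, ‖b‖ ≤ C ∧ ∀ (E : FinSet μ) (a : Lp ℝ ∞ ν),
      ∫ x in E.1, (b a : M → ℝ) x ∂μ = B (Finsupp.single E a) := by
  classical
  have habs : ∀ φ, |B φ| ≤ C * ∫ x, ‖stepFun x φ‖ ∂μ := by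
    intro φ
    refine abs_le'.2 ⟨hB φ, ?_⟩
    have := hB (-φ)
    simpa using this
  have hex : ∀ a : Lp ℝ ∞ ν, ∃ k : Lp ℝ ∞ μ, ‖k‖ ≤ C * ‖a‖ ∧
      ∀ E : FinSet μ, ∫ x in E.1, k x ∂μ = B (Finsupp.single E a) := by
    intro a
    let β : Set M → ℝ := fun E =>
      if h : MeasurableSet E ∧ μ E < ∞ then B (Finsupp.single ⟨E, h⟩ a) else 0
    have hβ : ∀ E (h : MeasurableSet E ∧ μ E < ∞), β E = B (Finsupp.single ⟨E, h⟩ a) :=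
      fun E h => dif_pos h
    obtain ⟨k, hk1, hk2⟩ := exists_linf_density hμ (β := β) (C := C * ‖a‖)
      (mul_nonneg hC (norm_nonneg _))
      (fun A A' hA hA' hfin hfin' hdisj => by
        have hfun : μ (A ∪ A') < ∞ := measure_union_lt_top hfin hfin'
        rw [hβ _ ⟨hA.union hA', hfun⟩, hβ _ ⟨hA, hfin⟩, hβ _ ⟨hA', hfin'⟩, ← map_add,
          ← sub_eq_zero, ← map_sub]
        refine abs_nonpos_iff.1 ((habs _).trans (le_of_eq ?_))
        -- The two formal sums differ but represent the same step function; the bound on `B` makes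
        -- it vanish on their difference.
        have h0 : ∀ x, stepFun x (Finsupp.single (⟨A ∪ A', hA.union hA', hfun⟩ : FinSet μ) a -
            (Finsupp.single (⟨A, hA, hfin⟩ : FinSet μ) a +
              Finsupp.single (⟨A', hA', hfin'⟩ : FinSet μ) a)) = 0 := by
          intro x
          rw [map_sub, map_add, stepFun_single, stepFun_single, stepFun_single,
            Set.indicator_union_of_disjoint hdisj, sub_self]
        simp [h0])
      (fun A hA hfin => by
        rw [hβ _ ⟨hA, hfin⟩]
        refine (habs _).trans (le_of_eq ?_)
        simp only [stepFun_single, norm_indicator_eq_indicator_norm]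
        rw [integral_indicator_const _ hA, smul_eq_mul]
        ring)
    exact ⟨k, hk1, fun E => by rw [hk2 E.1 E.2.1 E.2.2, hβ _ E.2]⟩
  choose k hk1 hk2 using hex
  have hkadd : ∀ a a', k (a + a') = k a + k a' := by
    intro a a'
    refine linf_ext_of_setIntegral_eq hμ.semifinite fun E hE hfin => ?_
    rw [hk2 _ ⟨E, hE, hfin⟩, setIntegral_congr_ae hE
      ((Lp.coeFn_add (k a) (k a')).mono fun x hx _ => hx), integral_add'
      (integrableOn_linf _ hfin) (integrableOn_linf _ hfin), hk2 _ ⟨E, hE, hfin⟩,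
      hk2 _ ⟨E, hE, hfin⟩, Finsupp.single_add, map_add]
  have hksmul : ∀ (c : ℝ) a, k (c • a) = c • k a := by
    intro c a
    refine linf_ext_of_setIntegral_eq hμ.semifinite fun E hE hfin => ?_
    rw [hk2 _ ⟨E, hE, hfin⟩, setIntegral_congr_ae hE
      ((Lp.coeFn_smul c (k a)).mono fun x hx _ => hx)]
    simp only [Pi.smul_apply]
    rw [integral_smul, hk2 _ ⟨E, hE, hfin⟩, ← Finsupp.smul_single, map_smul]
  exact ⟨LinearMap.mkContinuous { toFun := k, map_add' := hkadd, map_smul' := hksmul } C hk1,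
    LinearMap.mkContinuous_norm_le _ hC _, fun E a => hk2 a E⟩

/-- The bounds of the modulus on rectangles imply a decomposition of `u`. -/
theorem IsSupModulus.exists_decomposition (hμ : IsLocalizable μ) {u v : OpSpace μ ν}
    (huv : IsSupModulus u v) (hu : u ∈ sumB μ ν) {C C' : ℝ} (hC : 0 ≤ C) (hC' : 0 ≤ C')
    (hrect : ∀ (E : Set M) (F : Set N) (_ : MeasurableSet E) (hF : MeasurableSet F)
      (_ : μ E < ∞) (hν : ν F < ∞),
      ∫ x in E, (v (charFn hF hν)).1 x ∂μ ≤ C * μ.real E + C' * ν.real F) :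
    ∃ (b₀ : B0 μ ν) (b₁ : B1 μ ν), u = ofB0 μ ν b₀ + ofB1 μ ν b₁ ∧ ‖b₀‖ ≤ C ∧ ‖b₁‖ ≤ C' := by
  obtain ⟨B, hB1, hB2⟩ := exists_split_stepIntegral hC hC'
    fun ψ f hf => huv.stepIntegral_le hu hrect hC hC' ψ hf.1 hf.2
  obtain ⟨b₀, hb₀, hb₀B⟩ := exists_B0_of_functional hμ hC B hB1
  let w : OpSpace μ ν := u - ofB0 μ ν b₀
  have hwint : ∀ (f : InterSpace ν) (E : FinSet μ), ∫ x in E.1, (w f).1 x ∂μ =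
      stepIntegral u (Finsupp.single E f) -
        B (Finsupp.mapRange.linearMap (toLinf ν) (Finsupp.single E f)) := by
    intro f E
    rw [Finsupp.mapRange.linearMap_apply, Finsupp.mapRange_single, ← hb₀B, stepIntegral_single,
      ← integral_sub (integrableOn_sumSpace _ E.2.2) (integrableOn_linf _ E.2.2)]
    refine setIntegral_congr_ae E.2.1 ?_
    filter_upwards [AEEqFun.coeFn_sub (u f).1 (b₀ (toLinf ν f)).1] with x hx _
    exact hx
  have hwbd : ∀ (f : InterSpace ν) (E : Set M), MeasurableSet E → μ E < ∞ →
      ∫ x in E, ‖(w f).1 x‖ ∂μ ≤ C' * ‖toL1 ν f‖ := by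
    intro f E hE hfin
    have hm : MeasurableSet {x | 0 < (w f).1 x} :=
      measurableSet_lt measurable_const (w f).1.measurable
    have hfp : μ (E ∩ {x | 0 < (w f).1 x}) < ∞ :=
      (measure_mono Set.inter_subset_left).trans_lt hfin
    have hfn : μ (E ∩ {x | 0 < (w f).1 x}ᶜ) < ∞ :=
      (measure_mono Set.inter_subset_left).trans_lt hfin
    -- Taking `f` where `w f > 0` and `-f` elsewhere on `E` gives a step function dominated by
    -- `|f|`, on which the second functional equals `∫_E |w f|`.
    let Ep : FinSet μ := ⟨E ∩ {x | 0 < (w f).1 x}, hE.inter hm, hfp⟩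
    let En : FinSet μ := ⟨E ∩ {x | 0 < (w f).1 x}ᶜ, hE.inter hm.compl, hfn⟩
    have hint : IntegrableOn (fun x => ‖(w f).1 x‖) E μ := (integrableOn_sumSpace _ hfin).norm
    have h1 : ∫ x in E, ‖(w f).1 x‖ ∂μ =
        ∫ x in Ep.1, (w f).1 x ∂μ + ∫ x in En.1, (w (-f)).1 x ∂μ := by
      rw [← integral_inter_add_sdiff hm hint]
      congr 1
      · refine setIntegral_congr_fun Ep.2.1 fun x hx => ?_
        exact Real.norm_of_nonneg (le_of_lt hx.2)
      · refine setIntegral_congr_ae En.2.1 ?_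
        rw [map_neg]
        filter_upwards [AEEqFun.coeFn_neg (w f).1] with x e1 hx
        exact (Real.norm_of_nonpos (not_lt.1 hx.2)).trans e1.symm
    have hfabs := abs_mem_interSpace f
    have h2 := hB2 (Finsupp.single Ep f + Finsupp.single En (-f)) ⟨_, hfabs⟩ ⟨abs_nonneg _,
      fun x => by
        rw [map_add, stepFun_single, stepFun_single]
        by_cases hx : x ∈ Ep.1
        · have hx' : x ∉ En.1 := fun h => h.2 hx.2
          rw [Set.indicator_of_mem hx, Set.indicator_of_notMem hx', add_zero]
        · rw [Set.indicator_of_notMem hx, zero_add]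
          by_cases hx' : x ∈ En.1
          · rw [Set.indicator_of_mem hx', Submodule.coe_neg, abs_neg]
          · rw [Set.indicator_of_notMem hx', Submodule.coe_zero, abs_zero]
            exact abs_nonneg _⟩
    have h3 : ‖toL1 ν ⟨_, hfabs⟩‖ = ‖toL1 ν f‖ := norm_abs_eq_norm (toL1 ν f)
    rw [h3, map_add, map_add, map_add] at h2
    rw [h1, hwint f Ep, hwint (-f) En]
    linarith
  have hmem : ∀ f : InterSpace ν, ∃ hw : (w f).1 ∈ Lp ℝ 1 μ,
      ‖(⟨(w f).1, hw⟩ : Lp ℝ 1 μ)‖ ≤ C' * ‖toL1 ν f‖ := fun f =>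
    hμ.semifinite.memLp_one (w f) (mul_nonneg hC' (norm_nonneg _)) (hwbd f)
  let T : InterSpace ν →ₗ[ℝ] Lp ℝ 1 μ :=
    { toFun := fun f => ⟨(w f).1, (hmem f).1⟩
      map_add' := fun f g => Subtype.ext (congrArg (fun g : SumSpace μ => g.1) (w.map_add f g))
      map_smul' := fun c f => Subtype.ext (congrArg (fun g : SumSpace μ => g.1) (w.map_smul c f)) }
  have hT : ∀ f, ‖T f‖ ≤ C' * ‖toL1 ν f‖ := fun f => (hmem f).2
  refine ⟨b₀, T.extendOfNorm (toL1 ν), ?_, hb₀, ?_⟩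
  · refine LinearMap.ext fun f => Subtype.ext ?_
    have h1 : T.extendOfNorm (toL1 ν) (toL1 ν f) = T f :=
      LinearMap.extendOfNorm_eq (denseRange_toL1 ν) ⟨C', hT⟩ f
    have h2 : (ofB1 μ ν (T.extendOfNorm (toL1 ν)) f).1 = (w f).1 := 
      congrArg (fun g : Lp ℝ 1 μ => g.1) h1
    have h3 : (u f).1 = (ofB0 μ ν b₀ f).1 + (w f).1 := by
      change (u f).1 = (ofB0 μ ν b₀ f).1 + ((u f).1 - (ofB0 μ ν b₀ f).1)
      abel
    rw [h3, ← h2]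
    rfl
  · exact ContinuousLinearMap.opNorm_le_bound _ hC' fun x =>
      LinearMap.norm_extendOfNorm_apply_le (denseRange_toL1 ν) C' hT x

end Splitting

/-! ### The two inequalities of the theorem. -/

section Conclusion

variable {M N : Type*} [MeasurableSpace M] [MeasurableSpace N] {μ : Measure M} {ν : Measure N}

theorem norm_toLinf_charFn_le {F : Set N} (hF : MeasurableSet F) (hν : ν F < ∞) :
    ‖toLinf ν (charFn hF hν)‖ ≤ 1 := by
  refine linf_norm_le zero_le_one ?_
  filter_upwards [coeFn_charFn hF hν] with y hy
  have : (toLinf ν (charFn hF hν) : N → ℝ) y = F.indicator (fun _ => (1 : ℝ)) y := hy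
  rw [this]
  exact (norm_indicator_le_norm_self _ _).trans norm_one.le

theorem norm_toL1_charFn {F : Set N} (hF : MeasurableSet F) (hν : ν F < ∞) :
    ‖toL1 ν (charFn hF hν)‖ = ν.real F := by
  have : ∀ᵐ y ∂ν, ‖(toL1 ν (charFn hF hν) : N → ℝ) y‖ = F.indicator (fun _ => (1 : ℝ)) y := by
    filter_upwards [coeFn_charFn hF hν] with y hy
    have : (toL1 ν (charFn hF hν) : N → ℝ) y = F.indicator (fun _ => (1 : ℝ)) y := hy
    rw [this, Real.norm_of_nonneg (Set.indicator_nonneg (fun _ _ => zero_le_one) y)]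
  rw [L1.norm_eq_integral_norm, integral_congr_ae this, integral_indicator_const _ hF, smul_eq_mul,
    mul_one]

theorem IsSupModulus.pairing_charFn {u v : OpSpace μ ν} (huv : IsSupModulus u v) {E : Set M}
    (hE : μ E < ∞) {F : Set N} (hF : MeasurableSet F) (hν : ν F < ∞) :
    pairing (v (charFn hF hν)) E = ENNReal.ofReal (∫ x in E, (v (charFn hF hν)).1 x ∂μ) :=
  (ofReal_integral_eq_lintegral_ofReal (integrableOn_sumSpace _ hE)
    (ae_restrict_of_ae (ae_nonneg_of_nonneg (huv.nonneg (charFn_nonneg hF hν))))).symm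

theorem max_measure_eq_ofReal {t : ℝ} (ht : 0 < t) {E : Set M} (hE : μ E < ∞) {F : Set N}
    (hν : ν F < ∞) :
    max (μ E) (ENNReal.ofReal t⁻¹ * ν F) = ENNReal.ofReal (max (μ.real E) (t⁻¹ * ν.real F)) := by
  rw [ENNReal.ofReal_max, ENNReal.ofReal_mul (inv_nonneg.2 ht.le), ofReal_measureReal hE.ne,
    ofReal_measureReal hν.ne]

/-- With `m = max(μ(E), ν(F) / t)` one has `μ(E) ≤ m` and `ν(F) ≤ t m`, so the rectangle bound is at
most `(‖b₀‖ + t ‖b₁‖) m`. -/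
theorem IsSupModulus.supFun_le_Kfun {u v : OpSpace μ ν} (huv : IsSupModulus u v) {t : ℝ}
    (ht : 0 < t) : supFun t v ≤ Kfun μ ν t u := by
  refine le_iInf fun b₀ => le_iInf fun b₁ => le_iInf fun hu => ?_
  subst hu
  refine iSup_le fun E => iSup_le fun F => iSup_le fun hE => iSup_le fun hF => iSup_le fun hE0 =>
    iSup_le fun hEfin => iSup_le fun hF0 => iSup_le fun hν => ?_
  have hm0 : max (μ E) (ENNReal.ofReal t⁻¹ * ν F) ≠ 0 := (lt_max_of_lt_left hE0).ne'
  have hmtop : max (μ E) (ENNReal.ofReal t⁻¹ * ν F) ≠ ∞ := by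
    rw [max_measure_eq_ofReal ht hEfin hν]
    exact ENNReal.ofReal_ne_top
  rw [ENNReal.inv_mul_le_iff hm0 hmtop, max_measure_eq_ofReal ht hEfin hν,
    ← ENNReal.ofReal_mul (le_max_of_le_left measureReal_nonneg), huv.pairing_charFn hEfin hF hν]
  refine ENNReal.ofReal_le_ofReal ((huv.setIntegral_le (charFn_nonneg hF hν) hEfin).trans ?_)
  rw [norm_toL1_charFn, mul_add]
  refine add_le_add ?_ ?_
  · rw [mul_comm _ ‖b₀‖]
    refine mul_le_mul ?_ (le_max_left _ _) measureReal_nonneg (norm_nonneg _)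
    exact mul_le_of_le_one_right (norm_nonneg _) (norm_toLinf_charFn_le hF hν)
  · have h1 : ν.real F ≤ t * max (μ.real E) (t⁻¹ * ν.real F) := by
      have h2 := mul_le_mul_of_nonneg_left (le_max_right (μ.real E) (t⁻¹ * ν.real F)) ht.le
      rwa [mul_inv_cancel_left₀ ht.ne'] at h2
    calc ‖b₁‖ * ν.real F ≤ ‖b₁‖ * (t * max (μ.real E) (t⁻¹ * ν.real F)) :=
          mul_le_mul_of_nonneg_left h1 (norm_nonneg _)
      _ = _ := by ring

/-- The supremum only sees sets of positive measure; if `E` or `F` is null the integral is zero. -/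
theorem IsSupModulus.setIntegral_charFn_le {u v : OpSpace μ ν} (huv : IsSupModulus u v) {t : ℝ}
    (ht : 0 < t) (hfin : supFun t v ≠ ∞) {E : Set M} (hE : MeasurableSet E) (hEfin : μ E < ∞)
    {F : Set N} (hF : MeasurableSet F) (hν : ν F < ∞) :
    ∫ x in E, (v (charFn hF hν)).1 x ∂μ ≤
      (supFun t v).toReal * max (μ.real E) (t⁻¹ * ν.real F) := by
  have hnn : 0 ≤ (supFun t v).toReal * max (μ.real E) (t⁻¹ * ν.real F) :=
    mul_nonneg ENNReal.toReal_nonneg (le_max_of_le_left measureReal_nonneg)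
  rcases eq_or_ne (μ E) 0 with hE0 | hE0
  · rw [Measure.restrict_eq_zero.2 hE0, integral_zero_measure]
    exact hnn
  rcases eq_or_ne (ν F) 0 with hF0 | hF0
  · have h0 : charFn hF hν = 0 := by
      refine Subtype.ext (AEEqFun.ext ?_)
      have h1 : ∀ᵐ y ∂ν, y ∉ F := measure_eq_zero_iff_ae_notMem.1 hF0
      filter_upwards [coeFn_charFn hF hν, h1, AEEqFun.coeFn_zero (μ := ν) (β := ℝ)] with y e1 e2 e3
      rw [e1, Set.indicator_of_notMem e2]
      exact e3.symm
    have h2 : ∫ x in E, (v (charFn hF hν)).1 x ∂μ = 0 := by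
      rw [h0, map_zero]
      refine integral_eq_zero_of_ae (ae_restrict_of_ae ?_)
      exact AEEqFun.coeFn_zero
    rw [h2]
    exact hnn
  have hE1 : 0 < μ E := pos_iff_ne_zero.2 hE0
  have hF1 : 0 < ν F := pos_iff_ne_zero.2 hF0
  have h1 : (max (μ E) (ENNReal.ofReal t⁻¹ * ν F))⁻¹ * pairing (v (charFn hF hν)) E ≤
      supFun t v :=
    le_iSup_of_le E <| le_iSup_of_le F <| le_iSup_of_le hE <| le_iSup_of_le hF <|
      le_iSup_of_le hE1 <| le_iSup_of_le hEfin <| le_iSup_of_le hF1 <| le_iSup_of_le hν le_rfl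
  have hm0 : max (μ E) (ENNReal.ofReal t⁻¹ * ν F) ≠ 0 := (lt_max_of_lt_left hE1).ne'
  have hmtop : max (μ E) (ENNReal.ofReal t⁻¹ * ν F) ≠ ∞ := by
    rw [max_measure_eq_ofReal ht hEfin hν]
    exact ENNReal.ofReal_ne_top
  rw [ENNReal.inv_mul_le_iff hm0 hmtop, max_measure_eq_ofReal ht hEfin hν,
    huv.pairing_charFn hEfin hF hν, ← ENNReal.ofReal_toReal hfin,
    ← ENNReal.ofReal_mul (le_max_of_le_left measureReal_nonneg)] at h1
  rw [mul_comm]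
  rw [mul_comm] at hnn
  exact (ENNReal.ofReal_le_ofReal_iff hnn).1 h1

theorem IsSupModulus.half_Kfun_le_supFun (hμ : IsLocalizable μ) {u v : OpSpace μ ν}
    (huv : IsSupModulus u v) (hu : u ∈ sumB μ ν) {t : ℝ} (ht : 0 < t) :
    (1 / 2 : ℝ≥0∞) * Kfun μ ν t u ≤ supFun t v := by
  rcases eq_or_ne (supFun t v) ∞ with htop | htop
  · rw [htop]
    exact le_top
  set C := (supFun t v).toReal with hC
  have hC0 : 0 ≤ C := ENNReal.toReal_nonneg
  -- The maximum is replaced by the sum, giving the constants `C` and `C / t`; each then contributes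
  -- `C` to `‖b₀‖ + t ‖b₁‖`.
  obtain ⟨b₀, b₁, hub, h0, h1⟩ := huv.exists_decomposition hμ hu hC0
    (mul_nonneg hC0 (inv_nonneg.2 ht.le)) fun E F hE hF hEfin hν => by
      refine (huv.setIntegral_charFn_le ht htop hE hEfin hF hν).trans ?_
      rw [mul_assoc, ← mul_add]
      exact mul_le_mul_of_nonneg_left (max_le_add_of_nonneg measureReal_nonneg
        (mul_nonneg (inv_nonneg.2 ht.le) measureReal_nonneg)) hC0
  have hK : Kfun μ ν t u ≤ ENNReal.ofReal (2 * C) := by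
    refine iInf_le_of_le b₀ (iInf_le_of_le b₁ (iInf_le_of_le hub (ENNReal.ofReal_le_ofReal ?_)))
    have h2 := mul_le_mul_of_nonneg_left h1 ht.le
    have h3 : t * (C * t⁻¹) = C := by field_simp
    linarith
  calc (1 / 2 : ℝ≥0∞) * Kfun μ ν t u ≤ (1 / 2 : ℝ≥0∞) * ENNReal.ofReal (2 * C) := by gcongr
    _ = supFun t v := by
      rw [ENNReal.ofReal_mul zero_le_two, ENNReal.ofReal_ofNat, ← mul_assoc, one_div,
        ENNReal.inv_mul_cancel (by simp) (by simp), one_mul, hC, ENNReal.ofReal_toReal htop]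

end Conclusion

end OpInterp

theorem theorem4p1 {M N : Type*} [MeasurableSpace M] [MeasurableSpace N]
    (μ : Measure M) (ν : Measure N) (hμ : OpInterp.IsLocalizable μ)
    (u : OpInterp.OpSpace μ ν) (hu : u ∈ OpInterp.sumB μ ν) :
    ∃ v : OpInterp.OpSpace μ ν, OpInterp.IsModulus u v ∧
      ∀ t : ℝ, 0 < t →
        (1 / 2 : ℝ≥0∞) * OpInterp.Kfun μ ν t u ≤ OpInterp.supFun t v ∧
        OpInterp.supFun t v ≤ OpInterp.Kfun μ ν t u := by
  obtain ⟨v, hv⟩ := OpInterp.exists_isSupModulus hμ.dedekindComplete hu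
  exact ⟨v, hv.isModulus, fun t ht => ⟨hv.half_Kfun_le_supFun hμ hu ht, hv.supFun_le_Kfun ht⟩⟩
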